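/- For a bounded open set $D$ in a finite-dimensional complex vector space let $A(D)$ be the algebra of continuous functions on $\overline D$ that are holomorphic on $D$. The Shilov boundary $\partial_s D$ is the smallest closed subset $S\subset\overline D$ such that for every $g\in A(D)$ the maximum of $|g|$ over $\overline D$ is attained on $S$. A domain is a nonempty connected open set. Let $\mathcal R_{II}=\{z\in\mathcal M_{2\times2}(\mathbb C): z=z^t,\ \|z\|<1\}$ ($\|\cdot\|$ the operator norm), regarded as a domain in the space of symmetric matrices, let $\mathcal U$ be the set of unitary symmetric $2\times2$ matrices, let $\Pi(z)=(z_{1,1},z_{2,2},\det z)$, and let $\mathbb E=\Pi(\mathcal R_{II})\subset\mathbb C^3$ be the tetrablock. For $n\in\mathbb N$ let $\sigma_n:\mathbb C^n\to\mathbb C^n$ be the map whose components are the elementary symmetric polynomials of degrees $1,\dots,n$, and let $\mathbb G_n=\sigma_n(\mathbb D^n)$ be the symmetrized polydisc, where $\mathbb D$ is the open unit disc. All the Shilov boundaries below exist, and the following holds. (1) Tetrablock: $\partial_s\mathcal R_{II}=\mathcal U$ and $\partial_s\mathbb E=\Pi(\partial_s\mathcal R_{II})=\Pi(\mathcal U)$.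 (2) Symmetrized polydisc: $\partial_s\mathbb D^n=\mathbb T^n$ and $\partial_s\mathbb G_n=\sigma_n(\partial_s\mathbb D^n)=\sigma_n(\mathbb T^n)$, where $\mathbb T$ is the unit circle. (3) The general class: if $D,G\subset\mathbb C^n$ are domains, $f:D\to G$ is a proper holomorphic mapping and $L$ is a domain relatively compact in $G$, then $\partial_s L=f(\partial_s(f^{-1}(L)))$. (4) The tetrablock and the symmetrized polydiscs are covered by (3). The map $(z_{1,1},z_{2,2},z_{1,2})\mapsto(z_{1,1},z_{2,2},z_{1,1}z_{2,2}-z_{1,2}^2)$ (that is, $\Pi$ on symmetric matrices, in coordinates) and the maps $\sigma_n$ are proper holomorphic mappings of $\mathbb C^3$, respectively $\mathbb C^n$, to itself; $\mathbb E$ and $\mathbb G_n$ are bounded domains; and the preimages of $\mathbb E$ and $\mathbb G_n$ are $\mathcal R_{II}$ (in these coordinates) and $\mathbb D^n$. -/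

import Mathlib

open scoped Matrix.Norms.L2Operator

/-- `S` is a closed subset of `closure D` on which the modulus of every function of the algebra
`A(D)` (continuous on `closure D`, holomorphic on `D`) reaches its supremum over `closure D`. -/
def IsClosedBoundary {V : Type*} [NormedAddCommGroup V] [NormedSpace ℂ V] (D S : Set V) : Prop :=
  IsClosed S ∧ S ⊆ closure D ∧
    ∀ g : V → ℂ, DiffContOnCl ℂ g D → ∀ x ∈ closure D, ∃ y ∈ S, ‖g x‖ ≤ ‖g y‖

/-- `S` is the Shilov boundary of `D`, i.e. the smallest closed boundary for `A(D)`. -/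
def IsShilovBoundary {V : Type*} [NormedAddCommGroup V] [NormedSpace ℂ V] (D S : Set V) : Prop :=
  IsLeast {S | IsClosedBoundary D S} S

/-- The Shilov boundary as a set: the intersection of all closed boundaries. Whenever a smallest
closed boundary exists, it is this set, see `IsShilovBoundary.eq`. -/
def shilovBoundary {V : Type*} [NormedAddCommGroup V] [NormedSpace ℂ V] (D : Set V) : Set V :=
  ⋂₀ {S | IsClosedBoundary D S}

theorem IsShilovBoundary.eq {V : Type*} [NormedAddCommGroup V] [NormedSpace ℂ V] {D S : Set V}
    (h : IsShilovBoundary D S) : shilovBoundary D = S :=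
  Set.Subset.antisymm (Set.sInter_subset_of_mem h.1) (Set.subset_sInter fun _ hT => h.2 hT)

/-- A domain: a nonempty connected open set. -/
def IsDomainSet {V : Type*} [TopologicalSpace V] (D : Set V) : Prop :=
  IsOpen D ∧ IsConnected D

/-- `f` restricts to a proper holomorphic map from `D` to `G`. -/
def IsProperHolomorphic {V W : Type*} [NormedAddCommGroup V] [NormedSpace ℂ V]
    [NormedAddCommGroup W] [NormedSpace ℂ W] (f : V → W) (D : Set V) (G : Set W) : Prop :=
  DifferentiableOn ℂ f D ∧ Set.MapsTo f D G ∧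
    ∀ C ⊆ G, IsCompact C → IsCompact (D ∩ f ⁻¹' C)

/-- `L` is relatively compact in `G`. -/
def RelCompactIn {V : Type*} [TopologicalSpace V] (L G : Set V) : Prop :=
  IsCompact (closure L) ∧ closure L ⊆ G

/-- The complex vector space of symmetric `2 × 2` matrices, normed by the operator norm. -/
def SymMat : Submodule ℂ (Matrix (Fin 2) (Fin 2) ℂ) where
  carrier := {z | z.transpose = z}
  add_mem' := by
    intro a b ha hb
    simp only [Set.mem_ofPred_eq] at ha hb ⊢
    rw [Matrix.transpose_add, ha, hb]
  zero_mem' := Matrix.transpose_zero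
  smul_mem' := by
    intro c a ha
    simp only [Set.mem_ofPred_eq] at ha ⊢
    rw [Matrix.transpose_smul, ha]

/-- The classical Cartan domain of the second type, a domain in the space of symmetric matrices
(the norm is the operator norm for the Euclidean norm of `ℂ²`). -/
def cartanII : Set SymMat := {z | ‖(z : Matrix (Fin 2) (Fin 2) ℂ)‖ < 1}

/-- The symmetric unitary matrices. -/
def symUnitary : Set SymMat :=
  {z | (z : Matrix (Fin 2) (Fin 2) ℂ) ∈ Matrix.unitaryGroup (Fin 2) ℂ}

/-- The map `z ↦ (z₁₁, z₂₂, det z)`. -/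
def tetraMap (z : Matrix (Fin 2) (Fin 2) ℂ) : Fin 3 → ℂ := ![z 0 0, z 1 1, z.det]

/-- The tetrablock. -/
def tetrablock : Set (Fin 3 → ℂ) := (fun z : SymMat => tetraMap z) '' cartanII

/-- The symmetrization map of `ℂⁿ`, given by the elementary symmetric polynomials. -/
def symMap (n : ℕ) (z : Fin n → ℂ) : Fin n → ℂ :=
  fun k => ∑ s ∈ Finset.powersetCard (k.val + 1) (Finset.univ : Finset (Fin n)), ∏ i ∈ s, z i

/-- The open unit polydisc. -/
def polydisc (n : ℕ) : Set (Fin n → ℂ) := {z | ∀ i, ‖z i‖ < 1}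

/-- The unit torus. -/
def torus (n : ℕ) : Set (Fin n → ℂ) := {z | ∀ i, ‖z i‖ = 1}

/-- The symmetrized polydisc. -/
def symPolydisc (n : ℕ) : Set (Fin n → ℂ) := symMap n '' polydisc n

/-!
The trace `z ↦ ∑_{f w = z} h w` of a holomorphic function `h` over the fibres of a proper
holomorphic map `f`, counted with multiplicity, is again holomorphic. Over regular values this is
the inverse function theorem. Across critical values it follows from weak holomorphy: smoothing the
trace by a kernel `φ` gives `∫ h |det f'|² φ (f w - z) dw`, which is annihilated by `∂̄` because of
the Piola identity (the columns of the adjugate Jacobian are divergence free), and the kernels can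
be shrunk to a point.

The preimage under `f` of a closed boundary of `L` is then a closed boundary of `f⁻¹ L`: the
functions `g ∘ f` give one inclusion, and for the other one takes traces of the powers `hᵏ` of a
function on `f⁻¹ L` and lets `k → ∞`, so that the fibre point with the largest `|h|` dominates.

For a ball of a finite-dimensional norm, every complex extreme point carrying a peak function lies
in the Shilov boundary, while the maximum principle along complex discs moves the maximum to the
complex extreme points; this gives `𝒰` for the Cartan domain and `𝕋ⁿ` for the polydisc. The
tetrablock and the symmetrized polydisc are images of these under proper maps.
-/

section SeveralComplexVariables

open Filter Topology Metric Set
open scoped ContDiff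

section

variable {X F : Type*} [SeminormedAddCommGroup F] {f : X → F}

theorem dist_le_two_mul_of_forall_norm_le {s : Set X} {M : ℝ} {x y : X}
    (hb : ∀ z ∈ s, ‖f z‖ ≤ M) (hx : x ∈ s) (hy : y ∈ s) : dist (f x) (f y) ≤ 2 * M :=
  (dist_le_norm_add_norm _ _).trans (by linarith [hb x hx, hb y hy])

theorem exists_ball_subset_forall_norm_le [PseudoMetricSpace X] {U : Set X} {c : X} (hU : IsOpen U)
    (hf : ContinuousOn f U) (hc : c ∈ U) :
    ∃ r > 0, ball c r ⊆ U ∧ ∃ M, ∀ z ∈ ball c r, ‖f z‖ ≤ M := by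
  have hlt := (hf.continuousAt (hU.mem_nhds hc)).norm.eventually_lt_const (lt_add_one ‖f c‖)
  obtain ⟨r, hr, h⟩ := eventually_nhds_iff_ball.1 (hlt.and (hU.mem_nhds hc))
  exact ⟨r, hr, fun z hz => (h z hz).2, ‖f c‖ + 1, fun z hz => (h z hz).1.le⟩

end

variable {E F : Type*} [NormedAddCommGroup E] [NormedSpace ℂ E]
  [NormedAddCommGroup F] [NormedSpace ℂ F] {f : E → F} {c : E} {r M : ℝ}

theorem norm_fderiv_le_of_norm_le (hr : 0 < r) (hd : DifferentiableOn ℂ f (ball c r))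
    (hb : ∀ z ∈ ball c r, ‖f z‖ ≤ M) : ‖fderiv ℂ f c‖ ≤ 2 * M / r :=
  Complex.norm_fderiv_le_div_of_mapsTo_ball hd
    (fun _ hz => dist_le_two_mul_of_forall_norm_le hb hz (mem_ball_self hr)) hr

theorem norm_sub_sub_fderiv_le_of_norm_le (hr : 0 < r) (hd : DifferentiableOn ℂ f (ball c r))
    (hb : ∀ z ∈ ball c r, ‖f z‖ ≤ M) {w : E} (hw : w ∈ ball c r) :
    ‖f w - f c - fderiv ℂ f c (w - c)‖ ≤ 4 * M * (dist w c / r) ^ 2 := by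
  have hc : c ∈ ball c r := mem_ball_self hr
  have hlinear : ∀ z ∈ ball c r, ‖fderiv ℂ f c (z - c)‖ ≤ 2 * M := fun z hz =>
    calc ‖fderiv ℂ f c (z - c)‖ ≤ ‖fderiv ℂ f c‖ * ‖z - c‖ := (fderiv ℂ f c).le_opNorm _
      _ ≤ (2 * M / r) * r :=
        mul_le_mul (norm_fderiv_le_of_norm_le hr hd hb) (mem_ball_iff_norm.1 hz).le
          (norm_nonneg _) ((norm_nonneg _).trans (norm_fderiv_le_of_norm_le hr hd hb))
      _ = 2 * M := by field_simp
  have hfc : HasFDerivAt f (fderiv ℂ f c) c :=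
    (hd.differentiableAt (ball_mem_nhds c hr)).hasFDerivAt
  have schwarz := Complex.dist_le_mul_div_pow_of_mapsTo_ball_of_isLittleO
    (f := fun z => f z - f c - fderiv ℂ f c (z - c)) (c := c) (z := w) (R₁ := r) (R₂ := 4 * M)
    (n := 1) ?_ ?_ ?_ hw
  · simpa [dist_eq_norm] using schwarz
  · exact (hd.sub_const _).sub
      ((fderiv ℂ f c).differentiable.comp (differentiable_id.sub_const c)).differentiableOn
  · intro z hz
    have hdist := dist_le_two_mul_of_forall_norm_le hb hz hc
    rw [dist_eq_norm] at hdist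
    simp only [mem_closedBall, dist_eq_norm, sub_self, map_zero, sub_zero]
    linarith [norm_sub_le (f z - f c) (fderiv ℂ f c (z - c)), hlinear z hz]
  · simpa [hasFDerivAt_iff_isLittleO] using (hasFDerivAt_iff_isLittleO.1 hfc).norm_right

theorem hasFDerivAt_of_norm_sub_sub_le_sq {f' : E →L[ℂ] F} {C : ℝ}
    (h : ∀ᶠ w in 𝓝 c, ‖f w - f c - f' (w - c)‖ ≤ C * ‖w - c‖ ^ 2) : HasFDerivAt f f' c := by
  have hbig : (fun w => f w - f c - f' (w - c)) =O[𝓝 c] fun w => ‖w - c‖ ^ 2 :=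
    Asymptotics.IsBigO.of_bound C (by simpa using h)
  have hsub : Tendsto (fun w => w - c) (𝓝 c) (𝓝 0) := by
    simpa using (continuous_sub_right c).tendsto c
  exact hasFDerivAt_iff_isLittleO.2 <| hbig.trans_isLittleO <|
    (Asymptotics.isLittleO_norm_pow_id (E' := E) one_lt_two).comp_tendsto hsub

/- A limit of the derivatives at `c` along an ultrafilter exists by compactness, and the uniform
second order Taylor estimate passes to the limit. -/
theorem differentiableAt_of_tendsto_of_norm_le [FiniteDimensional ℂ E] [FiniteDimensional ℂ F]
    {ι : Type*} {l : Filter ι} [l.NeBot] {T : ι → E → F}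
    (hr : 0 < r) (hd : ∀ᶠ i in l, DifferentiableOn ℂ (T i) (ball c r))
    (hb : ∀ᶠ i in l, ∀ z ∈ ball c r, ‖T i z‖ ≤ M)
    (hlim : ∀ z ∈ ball c r, Tendsto (fun i => T i z) l (𝓝 (f z))) :
    DifferentiableAt ℂ f c := by
  have hc : c ∈ ball c r := mem_ball_self hr
  have : ProperSpace (E →L[ℂ] F) := FiniteDimensional.proper ℂ _
  let u : Ultrafilter ι := Ultrafilter.of l
  have hu : (u : Filter ι) ≤ l := Ultrafilter.of_le l
  have hbounded : ∀ᶠ i in u, fderiv ℂ (T i) c ∈ closedBall 0 (2 * M / r) := by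
    filter_upwards [hu hd, hu hb] with i hdi hbi
    exact mem_closedBall_zero_iff.2 (norm_fderiv_le_of_norm_le hr hdi hbi)
  obtain ⟨f', -, hf'⟩ := (isCompact_closedBall (0 : E →L[ℂ] F) (2 * M / r)).ultrafilter_le_nhds
    (u.map fun i => fderiv ℂ (T i) c) (le_principal_iff.2 hbounded)
  refine (hasFDerivAt_of_norm_sub_sub_le_sq (f' := f') (C := 4 * M / r ^ 2) ?_).differentiableAt
  filter_upwards [ball_mem_nhds c hr] with w hw
  have htendsto : Tendsto (fun i => ‖T i w - T i c - fderiv ℂ (T i) c (w - c)‖) u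
      (𝓝 ‖f w - f c - f' (w - c)‖) :=
    ((((hlim w hw).mono_left hu).sub ((hlim c hc).mono_left hu)).sub
      (((ContinuousLinearMap.apply ℂ F (w - c)).continuous.tendsto f').comp hf')).norm
  refine le_of_tendsto htendsto ?_
  filter_upwards [hu hd, hu hb] with i hdi hbi
  calc _ ≤ 4 * M * (dist w c / r) ^ 2 := norm_sub_sub_fderiv_le_of_norm_le hr hdi hbi hw
    _ = 4 * M / r ^ 2 * ‖w - c‖ ^ 2 := by rw [dist_eq_norm]; ring

theorem dist_le_mul_dist_of_norm_le (hd : DifferentiableOn ℂ f (ball c (3 * r)))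
    (hb : ∀ z ∈ ball c (3 * r), ‖f z‖ ≤ M) {x y : E} (hx : x ∈ ball c r) (hy : y ∈ ball c r) :
    dist (f x) (f y) ≤ M / r * dist x y := by
  rw [mem_ball] at hx hy
  have hr : 0 < r := dist_nonneg.trans_lt hx
  have hsub : ball y (2 * r) ⊆ ball c (3 * r) := ball_subset_ball' (by linarith)
  rw [← mul_div_mul_left M r two_ne_zero]
  refine Complex.dist_le_div_mul_dist_of_mapsTo_ball (hd.mono hsub) (fun z hz => ?_) ?_
  · exact dist_le_two_mul_of_forall_norm_le hb (hsub hz) (hsub (mem_ball_self (by positivity)))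
  · rw [mem_ball]
    linarith [dist_triangle_right x y c]

theorem differentiableOn_fderiv_apply_of_isOpen [FiniteDimensional ℂ E] [FiniteDimensional ℂ F]
    {U : Set E} (hU : IsOpen U) (hf : DifferentiableOn ℂ f U) (v : E) :
    DifferentiableOn ℂ (fun z => fderiv ℂ f z v) U := by
  intro c hc
  obtain ⟨R, hR, hRU, M, hM⟩ := exists_ball_subset_forall_norm_le hU hf.continuousOn hc
  obtain ⟨r, rfl⟩ : ∃ r, R = 3 * r := ⟨R / 3, by ring⟩
  have hr : 0 < r := by linarith
  have hsmall : ∀ᶠ s in 𝓝[≠] (0 : ℂ), ‖s • v‖ < r / 2 := by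
    have : Tendsto (fun s : ℂ => ‖s • v‖) (𝓝 0) (𝓝 0) := by
      simpa using (show Continuous fun s : ℂ => ‖s • v‖ by fun_prop).tendsto 0
    exact (this.mono_left nhdsWithin_le_nhds).eventually_lt_const (by positivity)
  have hshift : ∀ {s : ℂ} {z}, ‖s • v‖ < r / 2 → z ∈ ball c (r / 2) → z + s • v ∈ ball c r := by
    intro s z hs hz
    rw [mem_ball_iff_norm] at hz ⊢
    rw [add_sub_right_comm]
    linarith [norm_add_le (z - c) (s • v)]
  refine (differentiableAt_of_tendsto_of_norm_le (l := 𝓝[≠] (0 : ℂ)) (r := r / 2)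
    (M := M / r * ‖v‖) (T := fun s z => s⁻¹ • (f (z + s • v) - f z))
    (by positivity) ?_ ?_ fun z hz => ?_).differentiableWithinAt
  · filter_upwards [hsmall] with s hs
    refine ((hf.comp (differentiableOn_id.add_const _) fun z hz => hRU ?_).sub
      (hf.mono ((ball_subset_ball (by linarith)).trans hRU))).const_smul _
    exact ball_subset_ball (by linarith) (hshift hs hz)
  · filter_upwards [hsmall, self_mem_nhdsWithin] with s hs hs0 z hz
    have hlip := dist_le_mul_dist_of_norm_le (hf.mono hRU) hM (hshift hs hz)
      (ball_subset_ball (by linarith) hz)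
    rw [dist_eq_norm, dist_eq_norm, add_sub_cancel_left, norm_smul] at hlip
    rw [norm_smul, norm_inv, inv_mul_le_iff₀ (norm_pos_iff.2 hs0)]
    linarith
  · have hzU : z ∈ U := hRU (ball_subset_ball (by linarith) hz)
    have hline := (hf.differentiableAt (hU.mem_nhds hzU)).hasFDerivAt.hasLineDerivAt v
    refine (hasDerivAt_iff_tendsto_slope.1 hline).congr fun s => ?_
    simp [slope_def_module]

theorem contDiffOn_of_differentiableOn_complex [FiniteDimensional ℂ E] [FiniteDimensional ℂ F]
    {U : Set E} (hU : IsOpen U) (hf : DifferentiableOn ℂ f U) : ContDiffOn ℂ ∞ f U := by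
  refine contDiffOn_infty.2 fun k => ?_
  induction k generalizing f with
  | zero => simpa using hf.continuousOn
  | succ k ih =>
    rw [Nat.cast_succ, contDiffOn_succ_iff_fderiv_apply hU.uniqueDiffOn]
    refine ⟨hf, by simp, fun v => ?_⟩
    exact (ih (differentiableOn_fderiv_apply_of_isOpen hU hf v)).congr fun z hz => by
      rw [fderivWithin_of_isOpen hU hz]

theorem differentiableOn_fderiv_of_isOpen [FiniteDimensional ℂ E] [FiniteDimensional ℂ F]
    {U : Set E} (hU : IsOpen U) (hf : DifferentiableOn ℂ f U) :
    DifferentiableOn ℂ (fderiv ℂ f) U :=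
  ((contDiffOn_infty_iff_fderiv_of_isOpen hU).1
    (contDiffOn_of_differentiableOn_complex hU hf)).2.differentiableOn (by norm_num)

theorem contDiffAt_real_of_differentiableOn_complex [FiniteDimensional ℂ E]
    [FiniteDimensional ℂ F] {U : Set E} (hU : IsOpen U) (hf : DifferentiableOn ℂ f U)
    (hc : c ∈ U) : ContDiffAt ℝ ∞ f c :=
  ((contDiffOn_of_differentiableOn_complex hU hf).restrict_scalars ℝ).contDiffAt (hU.mem_nhds hc)

theorem eqOn_zero_ball_of_eventuallyEq_zero [CompleteSpace F]
    (hf : DifferentiableOn ℂ f (ball c r)) {p : E}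
    (hp : p ∈ ball c r) (h0 : f =ᶠ[𝓝 p] 0) : EqOn f 0 (ball c r) := by
  intro z hz
  let line : ℂ → E := fun ζ => p + ζ • (z - p)
  have hline : Differentiable ℂ line := by fun_prop
  have hline0 : line 0 = p := by simp [line]
  have hline1 : line 1 = z := by simp [line]
  have hconvex : Convex ℝ (line ⁻¹' ball c r) := by
    have := ((convex_ball c r).translate_preimage_right p).linear_preimage
      ((LinearMap.toSpanSingleton ℂ E (z - p)).restrictScalars ℝ)
    exact this
  have hanalytic : AnalyticOnNhd ℂ (f ∘ line) (line ⁻¹' ball c r) :=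
    (hf.comp hline.differentiableOn fun _ hζ => hζ).analyticOnNhd
      (isOpen_ball.preimage hline.continuous)
  have hzero : f ∘ line =ᶠ[𝓝 0] 0 :=
    (hline.continuous.tendsto' 0 p hline0).eventually h0
  have heq := hanalytic.eqOn_zero_of_preconnected_of_eventuallyEq_zero hconvex.isPreconnected
    (by simpa [hline0] using hp) hzero (x := 1) (by simpa [hline1] using hz)
  simpa [hline1] using heq

theorem eqOn_zero_of_differentiableOn_of_eventuallyEq_zero [CompleteSpace F] {U : Set E}
    (hU : IsOpen U) (hUc : IsPreconnected U) (hf : DifferentiableOn ℂ f U) (hc : c ∈ U)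
    (h0 : f =ᶠ[𝓝 c] 0) : EqOn f 0 U := by
  suffices h : U ⊆ interior {z | f z = 0} from
    fun z hz => interior_subset (s := {z | f z = 0}) (h hz)
  refine hUc.subset_of_closure_inter_subset isOpen_interior
    ⟨c, hc, mem_interior_iff_mem_nhds.2 h0⟩ ?_
  rintro w ⟨hw, hwU⟩
  obtain ⟨r, hr, hrU⟩ := Metric.isOpen_iff.1 hU w hwU
  obtain ⟨p, hp, hwp⟩ := Metric.mem_closure_iff.1 hw r hr
  exact mem_interior.2 ⟨ball w r, eqOn_zero_ball_of_eventuallyEq_zero (hf.mono hrU)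
    (mem_ball'.2 hwp) (mem_interior_iff_mem_nhds.1 hp), isOpen_ball, mem_ball_self hr⟩

end SeveralComplexVariables

noncomputable section PiolaIdentity

open Filter Topology Set

variable {n : ℕ}

/-- The determinant as a continuous multilinear map of the rows. -/
def detContinuousMultilinearMap (n : ℕ) :
    ContinuousMultilinearMap ℂ (fun _ : Fin n => Fin n → ℂ) ℂ where
  toMultilinearMap := (Matrix.detRowAlternating : (Fin n → ℂ) [⋀^Fin n]→ₗ[ℂ] ℂ).toMultilinearMap
  cont := by
    change Continuous fun M : Fin n → Fin n → ℂ => Matrix.det (Matrix.of M)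
    exact Continuous.matrix_det (continuous_id (X := Fin n → Fin n → ℂ))

theorem detContinuousMultilinearMap_apply (M : Fin n → Fin n → ℂ) :
    detContinuousMultilinearMap n M = Matrix.det (Matrix.of M) := rfl

theorem detContinuousMultilinearMap_update_update_swap (M : Fin n → Fin n → ℂ) {k i : Fin n}
    (hki : k ≠ i) (v s : Fin n → ℂ) :
    detContinuousMultilinearMap n (Function.update (Function.update M k v) i s) =
      -detContinuousMultilinearMap n (Function.update (Function.update M i v) k s) := by
  have hswap : Function.update (Function.update M i v) k s ∘ Equiv.swap k i =
      Function.update (Function.update M k v) i s := by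
    funext j
    rcases eq_or_ne j k with rfl | hjk
    · simp [hki, hki.symm]
    rcases eq_or_ne j i with rfl | hji
    · simp
    · simp [hjk, hji, Equiv.swap_apply_of_ne_of_ne]
  rw [← hswap]
  exact (Matrix.detRowAlternating : (Fin n → ℂ) [⋀^Fin n]→ₗ[ℂ] ℂ).map_swap _ hki

/-- The complex Jacobian determinant `det f'`. -/
def jacDet (f : (Fin n → ℂ) → (Fin n → ℂ)) (w : Fin n → ℂ) : ℂ := (fderiv ℂ f w).det

/-- The partial derivatives of `f` at `w`, that is, the columns of the Jacobian matrix. They are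
used as the arguments of the multilinear determinant. -/
def partialDerivs (f : (Fin n → ℂ) → (Fin n → ℂ)) (w : Fin n → ℂ) : Fin n → Fin n → ℂ :=
  fun l => fderiv ℂ f w (Pi.single l 1)

/-- The vector field `adj(f') v`, with `adj(f')` the adjugate of the Jacobian matrix, written by
Cramer's rule. -/
def cramerField (f : (Fin n → ℂ) → (Fin n → ℂ)) (v w : Fin n → ℂ) : Fin n → ℂ :=
  fun k => detContinuousMultilinearMap n (Function.update (partialDerivs f w) k v)

theorem jacDet_eq_detContinuousMultilinearMap (f : (Fin n → ℂ) → (Fin n → ℂ)) (w : Fin n → ℂ) :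
    jacDet f w = detContinuousMultilinearMap n (partialDerivs f w) := by
  rw [detContinuousMultilinearMap_apply, ← Matrix.det_transpose, jacDet,
    ContinuousLinearMap.det, ← LinearMap.det_toMatrix']
  rfl

theorem cramerField_eq_cramer (f : (Fin n → ℂ) → (Fin n → ℂ)) (v w : Fin n → ℂ) :
    cramerField f v w = Matrix.cramer (Matrix.of (partialDerivs f w)).transpose v := by
  funext k
  rw [Matrix.cramer_transpose_apply]
  rfl

theorem fderiv_apply_eq_mulVec (f : (Fin n → ℂ) → (Fin n → ℂ)) (w x : Fin n → ℂ) :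
    fderiv ℂ f w x = (Matrix.of (partialDerivs f w)).transpose.mulVec x := by
  conv_lhs => rw [pi_eq_sum_univ' x, map_sum]
  funext i
  simp [Matrix.mulVec, dotProduct, partialDerivs, mul_comm]

theorem fderiv_cramerField (f : (Fin n → ℂ) → (Fin n → ℂ)) (v w : Fin n → ℂ) :
    fderiv ℂ f w (cramerField f v w) = jacDet f w • v := by
  rw [fderiv_apply_eq_mulVec, cramerField_eq_cramer, Matrix.mulVec_cramer, Matrix.det_transpose,
    jacDet_eq_detContinuousMultilinearMap, detContinuousMultilinearMap_apply]

variable {f : (Fin n → ℂ) → (Fin n → ℂ)} {U : Set (Fin n → ℂ)}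

theorem differentiableOn_partialDerivs (hU : IsOpen U) (hf : DifferentiableOn ℂ f U)
    (l : Fin n) : DifferentiableOn ℂ (fun w => partialDerivs f w l) U :=
  differentiableOn_fderiv_apply_of_isOpen hU hf _

theorem differentiableOn_jacDet (hU : IsOpen U) (hf : DifferentiableOn ℂ f U) :
    DifferentiableOn ℂ (jacDet f) U := by
  rw [funext (jacDet_eq_detContinuousMultilinearMap f)]
  exact fun w hw => (HasFDerivAt.multilinear_comp (detContinuousMultilinearMap n) fun l =>
    ((differentiableOn_partialDerivs hU hf l).differentiableAt
      (hU.mem_nhds hw)).hasFDerivAt).differentiableAt.differentiableWithinAt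

theorem hasFDerivAt_cramerField (hU : IsOpen U) (hf : DifferentiableOn ℂ f U) {w : Fin n → ℂ}
    (hw : w ∈ U) (v : Fin n → ℂ) (k : Fin n) :
    HasFDerivAt (fun w => cramerField f v w k)
      (∑ i, (detContinuousMultilinearMap n).toContinuousLinearMap
        (Function.update (partialDerivs f w) k v) i ∘SL
          (if i = k then 0 else fderiv ℂ (fun w => partialDerivs f w i) w)) w := by
  refine HasFDerivAt.multilinear_comp (detContinuousMultilinearMap n) (x := w)
    (g := fun i w => Function.update (partialDerivs f w) k v i)
    (g' := fun i => if i = k then 0 else fderiv ℂ (fun w => partialDerivs f w i) w) fun i => ?_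
  rcases eq_or_ne i k with rfl | hi
  · simpa using hasFDerivAt_const (𝕜 := ℂ) v w
  · simpa [hi] using ((differentiableOn_partialDerivs hU hf i).differentiableAt
      (hU.mem_nhds hw)).hasFDerivAt

theorem differentiableOn_cramerField (hU : IsOpen U) (hf : DifferentiableOn ℂ f U)
    (v : Fin n → ℂ) (k : Fin n) : DifferentiableOn ℂ (fun w => cramerField f v w k) U :=
  fun _ hw => (hasFDerivAt_cramerField hU hf hw v k).differentiableAt.differentiableWithinAt

theorem fderiv_partialDerivs_symm (hU : IsOpen U) (hf : DifferentiableOn ℂ f U) {w : Fin n → ℂ}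
    (hw : w ∈ U) (i k : Fin n) :
    fderiv ℂ (fun w => partialDerivs f w i) w (Pi.single k 1) =
      fderiv ℂ (fun w => partialDerivs f w k) w (Pi.single i 1) := by
  have hsecond : HasFDerivAt (fderiv ℂ f) (fderiv ℂ (fderiv ℂ f) w) w :=
    ((differentiableOn_fderiv_of_isOpen hU hf).differentiableAt (hU.mem_nhds hw)).hasFDerivAt
  have hpartial : ∀ l a, fderiv ℂ (fun w => partialDerivs f w l) w a =
      fderiv ℂ (fderiv ℂ f) w a (Pi.single l 1) := fun l a => by
    have := (hsecond.clm_apply (hasFDerivAt_const (Pi.single l (1 : ℂ) : Fin n → ℂ) w)).fderiv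
    unfold partialDerivs
    rw [this]
    simp
  rw [hpartial, hpartial]
  exact second_derivative_symmetric_of_eventually
    (eventually_of_mem (hU.mem_nhds hw) fun y hy =>
      (hf.differentiableAt (hU.mem_nhds hy)).hasFDerivAt) hsecond _ _

/- The divergence is a double sum over pairs of columns, antisymmetric because exchanging two
columns changes the sign of the determinant while second derivatives commute. -/
theorem sum_fderiv_cramerField_eq_zero (hU : IsOpen U) (hf : DifferentiableOn ℂ f U)
    {w : Fin n → ℂ} (hw : w ∈ U) (v : Fin n → ℂ) :
    ∑ k, fderiv ℂ (fun w => cramerField f v w k) w (Pi.single k 1) = 0 := by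
  let a : Fin n → Fin n → ℂ := fun k i => if i = k then 0 else
    detContinuousMultilinearMap n (Function.update (Function.update (partialDerivs f w) k v) i
      (fderiv ℂ (fun w => partialDerivs f w i) w (Pi.single k 1)))
  have hterm : ∀ k, fderiv ℂ (fun w => cramerField f v w k) w (Pi.single k 1) = ∑ i, a k i := by
    intro k
    rw [(hasFDerivAt_cramerField hU hf hw v k).fderiv, sum_apply]
    refine Finset.sum_congr rfl fun i _ => ?_
    rcases eq_or_ne i k with rfl | hi
    · simp [a]
    · simp only [a, hi, if_false, ContinuousLinearMap.comp_apply]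
      rfl
  have hanti : ∀ k i, a k i = -a i k := by
    intro k i
    rcases eq_or_ne i k with rfl | hi
    · simp [a]
    · simp only [a, hi, hi.symm, if_false]
      rw [detContinuousMultilinearMap_update_update_swap _ hi.symm,
        fderiv_partialDerivs_symm hU hf hw]
  have hsum : ∑ k, ∑ i, a k i = -∑ k, ∑ i, a k i := by
    conv_lhs => rw [Finset.sum_comm]
    simp only [← Finset.sum_neg_distrib, ← hanti]
  simp_rw [hterm]
  exact self_eq_neg.1 hsum

end PiolaIdentity

noncomputable section Dbar

open Filter Topology Set MeasureTheory Complex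
open scoped ComplexConjugate

variable {E : Type*} [NormedAddCommGroup E] [NormedSpace ℂ E]

/-- Twice the conjugate-linear part of a real-linear functional. -/
def dbarPart (A : E →L[ℝ] ℂ) (v : E) : ℂ := A v + I * A (I • v)

/-- The conjugate-linear derivative `∂̄φ(z)(v)`, without the customary factor `1 / 2`. -/
def dbar (φ : E → ℂ) (z v : E) : ℂ := dbarPart (fderiv ℝ φ z) v

theorem map_smul_eq_re_add_im (A : E →L[ℝ] ℂ) (c : ℂ) (v : E) :
    A (c • v) = c.re * A v + c.im * A (I • v) := by
  have hc : c • v = c.re • v + c.im • (I • v) := by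
    conv_lhs => rw [← Complex.re_add_im c, add_smul, mul_smul]
    rfl
  rw [hc, map_add, A.map_smul, A.map_smul, Complex.real_smul, Complex.real_smul]

theorem dbarPart_smul (A : E →L[ℝ] ℂ) (c : ℂ) (v : E) :
    dbarPart A (c • v) = conj c * dbarPart A v := by
  have hconj : conj c = c.re - c.im * I := by apply Complex.ext <;> simp
  rw [dbarPart, dbarPart, smul_smul, map_smul_eq_re_add_im A c, map_smul_eq_re_add_im A (I * c),
    hconj]
  simp only [mul_re, I_re, I_im, mul_im]
  push_cast
  linear_combination (c.im * A (I • v)) * I_mul_I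

theorem dbarPart_add (A : E →L[ℝ] ℂ) (v w : E) :
    dbarPart A (v + w) = dbarPart A v + dbarPart A w := by
  simp only [dbarPart, smul_add, map_add]; ring

theorem dbarPart_eq_sum {n : ℕ} (A : (Fin n → ℂ) →L[ℝ] ℂ) (c : Fin n → ℂ) :
    dbarPart A c = ∑ k, conj (c k) * dbarPart A (Pi.single k 1) := by
  conv_lhs => rw [pi_eq_sum_univ' c]
  rw [← AddMonoidHom.mk'_apply (dbarPart A) (dbarPart_add A), map_sum]
  exact Finset.sum_congr rfl fun k _ => dbarPart_smul A _ _

theorem dbarPart_restrictScalars (A : E →L[ℂ] ℂ) (v : E) :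
    dbarPart (A.restrictScalars ℝ) v = 0 := by
  simp only [dbarPart, ContinuousLinearMap.coe_restrictScalars', map_smul, smul_eq_mul]
  linear_combination A v * I_mul_I

theorem map_smul_of_dbarPart_eq_zero {A : E →L[ℝ] ℂ} (hA : ∀ v, dbarPart A v = 0) (c : ℂ)
    (v : E) : A (c • v) = c * A v := by
  have hv := hA v
  rw [dbarPart] at hv
  rw [map_smul_eq_re_add_im]
  conv_rhs => rw [← Complex.re_add_im c]
  linear_combination (-I * c.im) * hv + c.im * A (I • v) * I_mul_I

theorem dbar_mul_mul_conj {u H X : E → ℂ} {w : E} (hu : DifferentiableAt ℝ u w)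
    (hH : DifferentiableAt ℂ H w) (hX : DifferentiableAt ℂ X w) (v : E) :
    dbar (fun w => u w * (H w * conj (X w))) w v =
      H w * conj (X w) * dbar u w v + 2 * u w * H w * conj (fderiv ℂ X w v) := by
  have hconj : HasFDerivAt (fun w => conj (X w))
      ((Complex.conjCLE : ℂ →L[ℝ] ℂ).comp ((fderiv ℂ X w).restrictScalars ℝ)) w :=
    (Complex.conjCLE : ℂ →L[ℝ] ℂ).hasFDerivAt.comp w (hX.hasFDerivAt.restrictScalars ℝ)
  have hprod : HasFDerivAt (fun w => u w * (H w * conj (X w))) _ w :=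
    hu.hasFDerivAt.mul ((hH.hasFDerivAt.restrictScalars ℝ).mul hconj)
  have hH0 := dbarPart_restrictScalars (fderiv ℂ H w) v
  rw [dbar, hprod.fderiv]
  simp only [dbar, dbarPart, add_apply, smul_apply,
    ContinuousLinearMap.comp_apply, ContinuousLinearMap.coe_restrictScalars', map_smul,
    smul_eq_mul, ContinuousLinearEquiv.coe_coe, Complex.conjCLE_apply, map_mul, conj_I] at hH0 ⊢
  linear_combination (u w * conj (X w)) * hH0 -
    u w * H w * conj (fderiv ℂ X w v) * I_mul_I

theorem dbar_comp {F : Type*} [NormedAddCommGroup F] [NormedSpace ℂ F] {φ : F → ℂ} {f : E → F}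
    {w : E} (hφ : DifferentiableAt ℝ φ (f w)) (hf : DifferentiableAt ℂ f w) (v : E) :
    dbar (fun w => φ (f w)) w v = dbar φ (f w) (fderiv ℂ f w v) := by
  have hcomp := hφ.hasFDerivAt.comp w (hf.hasFDerivAt.restrictScalars ℝ)
  rw [dbar, show (fun w => φ (f w)) = φ ∘ f from rfl, hcomp.fderiv]
  simp [dbar, dbarPart]

end Dbar

noncomputable section WeakHolomorphy

open Filter Topology Set MeasureTheory Complex
open scoped ComplexConjugate

theorem integrable_fderiv_apply {E : Type*} [NormedAddCommGroup E] [NormedSpace ℝ E]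
    [MeasurableSpace E] [OpensMeasurableSpace E] {μ : Measure E} [IsFiniteMeasureOnCompacts μ]
    {p : E → ℂ} (hp : ContDiff ℝ 1 p) (hc : HasCompactSupport p) (v : E) :
    Integrable (fun w => fderiv ℝ p w v) μ :=
  ((hp.continuous_fderiv one_ne_zero).clm_apply
    continuous_const).integrable_of_hasCompactSupport (hc.fderiv_apply (𝕜 := ℝ) v)

theorem integral_fderiv_apply_eq_zero {E : Type*} [NormedAddCommGroup E] [NormedSpace ℝ E]
    [FiniteDimensional ℝ E] [MeasurableSpace E] [BorelSpace E] {μ : Measure E}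
    [μ.IsAddHaarMeasure] {p : E → ℂ} (hp : ContDiff ℝ 1 p) (hc : HasCompactSupport p) (v : E) :
    ∫ w, fderiv ℝ p w v ∂μ = 0 := by
  have hparts := integral_mul_fderiv_eq_neg_fderiv_mul_of_integrable (μ := μ)
    (f := fun _ : E => (1 : ℂ)) (g := p) (v := v) (by simp)
    (by simpa using integrable_fderiv_apply hp hc v)
    (by simpa using hp.continuous.integrable_of_hasCompactSupport hc) (fun _ _ => by fun_prop)
    (fun x _ => hp.differentiable one_ne_zero x)
  simpa using hparts

section

variable {E : Type*} [NormedAddCommGroup E] [NormedSpace ℂ E] [MeasurableSpace E]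

theorem integrable_dbar [OpensMeasurableSpace E] {μ : Measure E} [IsFiniteMeasureOnCompacts μ]
    {p : E → ℂ} (hp : ContDiff ℝ 1 p) (hc : HasCompactSupport p) (v : E) :
    Integrable (fun w => dbar p w v) μ :=
  (integrable_fderiv_apply hp hc v).add ((integrable_fderiv_apply hp hc (I • v)).const_mul I)

variable [BorelSpace E] [FiniteDimensional ℂ E] {μ : Measure E} [μ.IsAddHaarMeasure]

theorem integral_dbar_eq_zero {p : E → ℂ} (hp : ContDiff ℝ 1 p) (hc : HasCompactSupport p)
    (v : E) : ∫ w, dbar p w v ∂μ = 0 := by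
  have : FiniteDimensional ℝ E := FiniteDimensional.complexToReal E
  simp only [dbar, dbarPart]
  rw [integral_add (integrable_fderiv_apply hp hc v)
    ((integrable_fderiv_apply hp hc (I • v)).const_mul I), integral_const_mul,
    integral_fderiv_apply_eq_zero hp hc, integral_fderiv_apply_eq_zero hp hc, mul_zero, add_zero]

theorem integrableOn_dbar_and_setIntegral_eq_zero {q : E → ℂ} {U K : Set E} (hU : IsOpen U)
    (hK : IsCompact K) (hKU : K ⊆ U) (hq : ∀ w ∈ U, ContDiffAt ℝ 1 q w)
    (hqK : ∀ w ∈ U, w ∉ K → q w = 0) (v : E) :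
    IntegrableOn (fun w => dbar q w v) U μ ∧ ∫ w in U, dbar q w v ∂μ = 0 := by
  have hpU : ∀ w ∈ U, U.indicator q =ᶠ[𝓝 w] q := fun w hw =>
    eventually_of_mem (hU.mem_nhds hw) fun _ hy => indicator_of_mem hy _
  have htsupport : tsupport (U.indicator q) ⊆ K :=
    closure_minimal (fun w hw => by
      by_contra hwK
      by_cases hwU : w ∈ U <;> simp_all) hK.isClosed
  have hsmooth : ContDiff ℝ 1 (U.indicator q) := contDiff_iff_contDiffAt.2 fun w => by
    by_cases hw : w ∈ U
    · exact (hq w hw).congr_of_eventuallyEq (hpU w hw)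
    · exact contDiffAt_const.congr_of_eventuallyEq
        (notMem_tsupport_iff_eventuallyEq.1 fun h => hw (hKU (htsupport h)))
  have hcompact : HasCompactSupport (U.indicator q) :=
    hK.of_isClosed_subset (isClosed_tsupport _) htsupport
  have hdbar : EqOn (fun w => dbar (U.indicator q) w v) (fun w => dbar q w v) U := fun w hw => by
    simp only [dbar, (hpU w hw).fderiv_eq]
  refine ⟨(integrable_dbar hsmooth hcompact v).integrableOn.congr_fun hdbar hU.measurableSet, ?_⟩
  rw [← setIntegral_congr_fun hU.measurableSet hdbar,
    setIntegral_eq_integral_of_forall_compl_eq_zero, integral_dbar_eq_zero hsmooth hcompact]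
  intro w hw
  rw [dbar, fderiv_of_notMem_tsupport _ fun h => hw (hKU (htsupport h))]
  simp [dbarPart]

end

variable {n : ℕ} {f : (Fin n → ℂ) → (Fin n → ℂ)} {h φ : (Fin n → ℂ) → ℂ} {U : Set (Fin n → ℂ)}

theorem sum_dbar_comp_mul_conj_cramerField (hU : IsOpen U) (hf : DifferentiableOn ℂ f U)
    {H : (Fin n → ℂ) → ℂ} {w : Fin n → ℂ} (hw : w ∈ U) (hH : DifferentiableAt ℂ H w)
    (hφ : DifferentiableAt ℝ φ (f w)) (v : Fin n → ℂ) :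
    ∑ k, dbar (fun w => φ (f w) * (H w * conj (cramerField f v w k))) w (Pi.single k 1) =
      H w * conj (jacDet f w) * dbar φ (f w) v := by
  have hfw : DifferentiableAt ℂ f w := hf.differentiableAt (hU.mem_nhds hw)
  have hterm := fun k => dbar_mul_mul_conj (u := fun w => φ (f w))
    (hφ.comp w (hfw.restrictScalars ℝ)) hH
    ((differentiableOn_cramerField hU hf v k).differentiableAt (hU.mem_nhds hw)) (Pi.single k 1)
  have hchain : ∑ k, conj (cramerField f v w k) * dbar (fun w => φ (f w)) w (Pi.single k 1) =
      conj (jacDet f w) * dbar φ (f w) v := by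
    simp only [dbar, ← dbarPart_eq_sum]
    rw [← dbar, dbar_comp hφ hfw, fderiv_cramerField, dbar, dbarPart_smul]
  simp only [hterm, Finset.sum_add_distrib, mul_assoc, ← Finset.mul_sum, ← map_sum, hchain,
    sum_fderiv_cramerField_eq_zero hU hf hw v, map_zero, mul_zero, add_zero]

theorem setIntegral_mul_dbar_comp_eq_zero {K : Set (Fin n → ℂ)} (hU : IsOpen U)
    (hf : DifferentiableOn ℂ f U) (hh : DifferentiableOn ℂ h U) (hφ : ContDiff ℝ 1 φ)
    (hK : IsCompact K) (hKU : K ⊆ U) (hsupp : ∀ w ∈ U, w ∉ K → φ (f w) = 0) (v : Fin n → ℂ) :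
    ∫ w in U, h w * (jacDet f w * conj (jacDet f w)) * dbar φ (f w) v = 0 := by
  have hH : DifferentiableOn ℂ (fun w => h w * jacDet f w) U :=
    hh.mul (differentiableOn_jacDet hU hf)
  have hsmooth : ∀ k, ∀ w ∈ U, ContDiffAt ℝ 1
      (fun w => φ (f w) * (h w * jacDet f w * conj (cramerField f v w k))) w := fun k w hw =>
    (hφ.contDiffAt.comp w
      ((contDiffAt_real_of_differentiableOn_complex hU hf hw).of_le (by norm_num))).mul
    (((contDiffAt_real_of_differentiableOn_complex hU hH hw).of_le (by norm_num)).mul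
      ((Complex.conjCLE : ℂ →L[ℝ] ℂ).contDiff.contDiffAt.comp w
        ((contDiffAt_real_of_differentiableOn_complex hU
          (differentiableOn_cramerField hU hf v k) hw).of_le (by norm_num))))
  have hzero := fun k => integrableOn_dbar_and_setIntegral_eq_zero (μ := volume) hU hK hKU
    (hsmooth k) (fun w hw hwK => by simp only [hsupp w hw hwK, zero_mul]) (Pi.single k 1)
  have hsum := integral_finsetSum (μ := volume.restrict U) Finset.univ fun k _ => (hzero k).1
  simp only [(hzero _).2, Finset.sum_const_zero] at hsum
  rw [← hsum]
  refine setIntegral_congr_fun hU.measurableSet fun w hw => ?_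
  simp only [sum_dbar_comp_mul_conj_cramerField hU hf hw (hH.differentiableAt (hU.mem_nhds hw))
    (hφ.differentiable one_ne_zero (f w)) v]
  ring

end WeakHolomorphy

noncomputable section SmoothTrace

open Filter Topology Metric Set MeasureTheory Complex
open scoped ComplexConjugate

section

variable {E : Type*} [NormedAddCommGroup E] [NormedSpace ℂ E]

theorem differentiableAt_of_hasFDerivAt_of_dbarPart_eq_zero {F : E → ℂ} {A : E →L[ℝ] ℂ} {z : E}
    (hF : HasFDerivAt F A z) (hA : ∀ v, dbarPart A v = 0) : DifferentiableAt ℂ F z :=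
  let A' : E →L[ℂ] ℂ :=
    { toFun := A
      map_add' := A.map_add
      map_smul' := map_smul_of_dbarPart_eq_zero hA
      cont := A.continuous }
  (hasFDerivAt_of_restrictScalars ℝ (f' := A') hF (by ext; rfl)).differentiableAt

theorem dbarPart_integral {X : Type*} [MeasurableSpace X] {μ : Measure X} {A : X → E →L[ℝ] ℂ}
    (hA : Integrable A μ) (v : E) : dbarPart (∫ x, A x ∂μ) v = ∫ x, dbarPart (A x) v ∂μ := by
  simp only [dbarPart]
  rw [integral_add (hA.apply_continuousLinearMap v)
    ((hA.apply_continuousLinearMap (I • v)).const_mul I), integral_const_mul,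
    ContinuousLinearMap.integral_apply hA, ContinuousLinearMap.integral_apply hA]

theorem hasFDerivAt_setIntegral_mul_comp_sub {X : Type*} [TopologicalSpace X] [T2Space X]
    [MeasurableSpace X] [OpensMeasurableSpace X] [SecondCountableTopology X]
    {μ : Measure X} [IsFiniteMeasureOnCompacts μ] {K : Set X} (hK : IsCompact K)
    {F : Type*} [NormedAddCommGroup F] [NormedSpace ℝ F]
    {g : X → ℂ} {f : X → F} {φ : F → ℂ} (hg : ContinuousOn g K) (hf : ContinuousOn f K)
    (hφ : ContDiff ℝ 1 φ) (hφc : HasCompactSupport φ) (z : F) :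
    IntegrableOn (fun w => g w • -(fderiv ℝ φ (f w - z))) K μ ∧
      HasFDerivAt (fun z => ∫ w in K, g w * φ (f w - z) ∂μ)
        (∫ w in K, g w • -(fderiv ℝ φ (f w - z)) ∂μ) z := by
  obtain ⟨C₁, hC₁⟩ := hK.exists_bound_of_continuousOn hg
  obtain ⟨C₂, hC₂⟩ := (hφ.continuous_fderiv one_ne_zero).bounded_above_of_compact_support
    (hφc.fderiv (𝕜 := ℝ))
  have hF : ∀ z, ContinuousOn (fun w => g w * φ (f w - z)) K := fun z =>
    hg.mul (hφ.continuous.comp_continuousOn (hf.sub continuousOn_const))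
  have hF' : ContinuousOn (fun w => g w • -(fderiv ℝ φ (f w - z))) K :=
    hg.smul ((hφ.continuous_fderiv one_ne_zero).comp_continuousOn (hf.sub continuousOn_const)).neg
  have hKm := hK.isClosed.measurableSet
  refine ⟨hF'.integrableOn_compact hK, hasFDerivAt_integral_of_dominated_of_fderiv_le (𝕜 := ℝ)
    (F' := fun z w => g w • -(fderiv ℝ φ (f w - z))) (bound := fun _ => C₁ * C₂) univ_mem
    (Eventually.of_forall fun z => (hF z).aestronglyMeasurable hKm)
    ((hF z).integrableOn_compact hK) (hF'.aestronglyMeasurable hKm) ?_ ?_ ?_⟩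
  · filter_upwards [ae_restrict_mem hKm] with w hw y _
    rw [norm_smul, norm_neg]
    exact mul_le_mul (hC₁ w hw) (hC₂ _) (norm_nonneg _) ((norm_nonneg _).trans (hC₁ w hw))
  · exact integrableOn_const hK.measure_ne_top
  · refine Eventually.of_forall fun w y _ => HasFDerivAt.const_mul ?_ (g w)
    simpa [Function.comp_def] using
      (hφ.differentiable one_ne_zero (f w - y)).hasFDerivAt.comp y
        ((hasFDerivAt_id y).const_sub (f w))

end

variable {n : ℕ} {f : (Fin n → ℂ) → (Fin n → ℂ)} {h φ : (Fin n → ℂ) → ℂ} {U : Set (Fin n → ℂ)}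

/-- The function `z ↦ ∫ h(w) |det f'(w)|² φ(f(w) - z) dw`, which smooths the push-forward
`z ↦ ∑_{f w = z} h w` by the kernel `φ`. -/
def smoothTrace (f : (Fin n → ℂ) → (Fin n → ℂ)) (U : Set (Fin n → ℂ)) (h φ : (Fin n → ℂ) → ℂ)
    (z : Fin n → ℂ) : ℂ :=
  ∫ w in U, h w * (jacDet f w * conj (jacDet f w)) * φ (f w - z)

theorem dbarPart_integral_eq_zero {K : Set (Fin n → ℂ)} (hU : IsOpen U)
    (hf : DifferentiableOn ℂ f U) (hh : DifferentiableOn ℂ h U) (hφ : ContDiff ℝ 1 φ)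
    (hK : IsCompact K) (hKU : K ⊆ U) {z : Fin n → ℂ}
    (hsupp : ∀ w ∈ U, f w - z ∈ tsupport φ → w ∈ K)
    (hint : IntegrableOn (fun w => (h w * (jacDet f w * conj (jacDet f w))) •
      -(fderiv ℝ φ (f w - z))) K) (v : Fin n → ℂ) :
    dbarPart (∫ w in K, (h w * (jacDet f w * conj (jacDet f w))) •
      -(fderiv ℝ φ (f w - z))) v = 0 := by
  have hweak := setIntegral_mul_dbar_comp_eq_zero (φ := fun y => φ (y - z)) hU hf hh
    (hφ.comp (contDiff_id.sub contDiff_const)) hK hKU (fun w hw hwK =>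
      image_eq_zero_of_notMem_tsupport fun hmem => hwK (hsupp w hw hmem)) v
  rw [dbarPart_integral hint, ← neg_eq_zero, ← integral_neg, ← hweak]
  rw [← setIntegral_eq_of_subset_of_forall_sdiff_eq_zero hU.measurableSet hKU fun w hw => ?_]
  · refine setIntegral_congr_fun hU.measurableSet fun w _ => ?_
    simp only [dbar, fderiv_comp_sub, dbarPart, smul_apply, neg_apply, smul_eq_mul]
    ring
  · simp [fderiv_of_notMem_tsupport ℝ fun hmem => hw.2 (hsupp w hw.1 hmem), dbarPart]

theorem differentiableOn_smoothTrace (hU : IsOpen U) (hf : DifferentiableOn ℂ f U)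
    (hh : DifferentiableOn ℂ h U) (hφ : ContDiff ℝ 1 φ) (hφc : HasCompactSupport φ)
    {K B : Set (Fin n → ℂ)} (hK : IsCompact K) (hKU : K ⊆ U) (hB : IsOpen B)
    (hsupp : ∀ z ∈ B, ∀ w ∈ U, f w - z ∈ tsupport φ → w ∈ K) :
    DifferentiableOn ℂ (smoothTrace f U h φ) B := by
  intro z hz
  have hJ := (differentiableOn_jacDet hU hf).continuousOn
  have hweight : ContinuousOn (fun w => h w * (jacDet f w * conj (jacDet f w))) K :=
    (hh.continuousOn.mul (hJ.mul (continuous_conj.comp_continuousOn hJ))).mono hKU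
  have hrestrict : smoothTrace f U h φ =ᶠ[𝓝 z] fun z =>
      ∫ w in K, h w * (jacDet f w * conj (jacDet f w)) * φ (f w - z) := by
    filter_upwards [hB.mem_nhds hz] with y hy
    refine setIntegral_eq_of_subset_of_forall_sdiff_eq_zero hU.measurableSet hKU fun w hw => ?_
    rw [image_eq_zero_of_notMem_tsupport fun hmem => hw.2 (hsupp y hy w hw.1 hmem), mul_zero]
  obtain ⟨hint, hderiv⟩ := hasFDerivAt_setIntegral_mul_comp_sub (μ := volume) hK hweight
    (hf.continuousOn.mono hKU) hφ hφc z
  exact (differentiableAt_of_hasFDerivAt_of_dbarPart_eq_zero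
    (hderiv.congr_of_eventuallyEq hrestrict)
    (dbarPart_integral_eq_zero hU hf hh hφ hK hKU (hsupp z hz) hint)).differentiableWithinAt

end SmoothTrace

noncomputable section RegularValues

open Filter Topology Metric Set MeasureTheory Complex
open scoped ComplexConjugate

variable {n : ℕ} {f : (Fin n → ℂ) → (Fin n → ℂ)} {h : (Fin n → ℂ) → ℂ}
  {U V G : Set (Fin n → ℂ)} {w z : Fin n → ℂ}

theorem exists_equiv_hasStrictFDerivAt (hU : IsOpen U) (hf : DifferentiableOn ℂ f U)
    (hw : w ∈ U) (hJ : jacDet f w ≠ 0) :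
    ∃ e : (Fin n → ℂ) ≃L[ℂ] Fin n → ℂ, HasStrictFDerivAt f (e : (Fin n → ℂ) →L[ℂ] Fin n → ℂ) w := by
  refine ⟨(fderiv ℂ f w).toContinuousLinearEquivOfDetNeZero (by simpa [jacDet] using hJ), ?_⟩
  rw [ContinuousLinearMap.coe_toContinuousLinearEquivOfDetNeZero]
  exact ((contDiffOn_of_differentiableOn_complex hU hf).contDiffAt
    (hU.mem_nhds hw)).hasStrictFDerivAt (by simp)

theorem exists_mem_nhds_injOn_of_jacDet_ne_zero (hU : IsOpen U) (hf : DifferentiableOn ℂ f U)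
    (hw : w ∈ U) (hJ : jacDet f w ≠ 0) : ∃ V ∈ 𝓝 w, InjOn f V := by
  obtain ⟨e, he⟩ := exists_equiv_hasStrictFDerivAt hU hf hw hJ
  let F := he.toOpenPartialHomeomorph f
  exact ⟨F.source, F.open_source.mem_nhds he.mem_toOpenPartialHomeomorph_source, F.injOn⟩

theorem map_nhds_eq_of_jacDet_ne_zero (hU : IsOpen U) (hf : DifferentiableOn ℂ f U)
    (hw : w ∈ U) (hJ : jacDet f w ≠ 0) : map f (𝓝 w) = 𝓝 (f w) :=
  let ⟨_, he⟩ := exists_equiv_hasStrictFDerivAt hU hf hw hJ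
  he.map_nhds_eq_of_equiv

theorem abs_det_restrictScalars (A : (Fin n → ℂ) →L[ℂ] (Fin n → ℂ)) :
    |(A.restrictScalars ℝ).det| = normSq A.det := by
  have hdet : (A.restrictScalars ℝ).det = normSq A.det := by
    rw [ContinuousLinearMap.det, ContinuousLinearMap.det, ← Algebra.norm_complex_apply]
    exact LinearMap.det_restrictScalars
  rw [hdet, abs_of_nonneg (normSq_nonneg _)]

theorem integrableOn_and_setIntegral_normSq_jacDet_mul (hV : IsOpen V)
    (hf : DifferentiableOn ℂ f V) (hinj : InjOn f V) {φ : (Fin n → ℂ) → ℝ} (hφ : Integrable φ)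
    (hsupp : ∀ y ∉ f '' V, φ y = 0) :
    IntegrableOn (fun w => normSq (jacDet f w) * φ (f w)) V ∧
      ∫ w in V, normSq (jacDet f w) * φ (f w) = ∫ y, φ y := by
  have hderiv : ∀ w ∈ V, HasFDerivWithinAt f ((fderiv ℂ f w).restrictScalars ℝ) V w :=
    fun w hw => ((hf.differentiableAt
      (hV.mem_nhds hw)).hasFDerivAt.restrictScalars ℝ).hasFDerivWithinAt
  have hintegrable := (integrableOn_image_iff_integrableOn_abs_det_fderiv_smul volume
    hV.measurableSet hderiv hinj φ).1 hφ.integrableOn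
  have hintegral := integral_image_eq_integral_abs_det_fderiv_smul volume hV.measurableSet
    hderiv hinj φ
  simp only [abs_det_restrictScalars, smul_eq_mul] at hintegrable hintegral
  rw [setIntegral_eq_integral_of_forall_compl_eq_zero hsupp] at hintegral
  exact ⟨hintegrable, hintegral.symm⟩

/-- `z` is a regular value of the restriction of `f` to `U`. -/
def IsRegularValue (f : (Fin n → ℂ) → (Fin n → ℂ)) (U : Set (Fin n → ℂ)) (z : Fin n → ℂ) :
    Prop := ∀ w ∈ U, f w = z → jacDet f w ≠ 0

theorem IsRegularValue.finite_fiber (hz : IsRegularValue f U z) (hU : IsOpen U)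
    (hf : DifferentiableOn ℂ f U) (hc : IsCompact (U ∩ f ⁻¹' {z})) :
    (U ∩ f ⁻¹' {z}).Finite := by
  have hlocal : ∀ w ∈ U ∩ f ⁻¹' {z}, ∃ V ∈ 𝓝 w, InjOn f V := fun w hw =>
    exists_mem_nhds_injOn_of_jacDet_ne_zero hU hf hw.1 (hz w hw.1 hw.2)
  choose! V hV hinj using hlocal
  obtain ⟨t, ht, hcover⟩ := hc.elim_nhds_subcover V hV
  refine t.finite_toSet.subset fun w hw => ?_
  obtain ⟨y, hy, hwy⟩ := mem_iUnion₂.1 (hcover hw)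
  have hfwy : f w = f y :=
    (mem_singleton_iff.1 hw.2).trans (mem_singleton_iff.1 (ht y hy).2).symm
  rwa [hinj y (ht y hy) hwy (mem_of_mem_nhds (hV y (ht y hy))) hfwy]

/-- The sum of `h` over the fiber of the restriction of `f` to `U` over `z` (and `0` if infinitely
many terms are nonzero). -/
def fiberSum (f : (Fin n → ℂ) → (Fin n → ℂ)) (U : Set (Fin n → ℂ)) (h : (Fin n → ℂ) → ℂ)
    (z : Fin n → ℂ) : ℂ := ∑ᶠ w ∈ U ∩ f ⁻¹' {z}, h w

/-- A sequence of bump functions shrinking to the origin. -/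
def shrinkingBump (n : ℕ) (i : ℕ) : ContDiffBump (0 : Fin n → ℂ) where
  rIn := 1 / (i + 2)
  rOut := 1 / (i + 1)
  rIn_pos := by positivity
  rIn_lt_rOut := by gcongr; linarith

/-- The complex-valued approximate identity given by the normalized `shrinkingBump`s. -/
def shrinkingKernel (n : ℕ) (i : ℕ) (y : Fin n → ℂ) : ℂ :=
  ((shrinkingBump n i).normed volume y : ℝ)

theorem contDiff_shrinkingKernel (i : ℕ) : ContDiff ℝ 1 (shrinkingKernel n i) :=
  Complex.ofRealCLM.contDiff.comp (ContDiffBump.contDiff_normed (n := 1) _)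

theorem tsupport_shrinkingKernel (i : ℕ) :
    tsupport (shrinkingKernel n i) ⊆ closedBall 0 (shrinkingBump n i).rOut := by
  rw [← (shrinkingBump n i).tsupport_normed_eq (μ := volume)]
  refine closure_mono fun y hy => ?_
  simpa [shrinkingKernel] using hy

theorem hasCompactSupport_shrinkingKernel (i : ℕ) : HasCompactSupport (shrinkingKernel n i) :=
  (isCompact_closedBall _ _).of_isClosed_subset (isClosed_tsupport _) (tsupport_shrinkingKernel i)

theorem eventually_tsupport_shrinkingKernel_subset_ball {r : ℝ} (hr : 0 < r) :
    ∀ᶠ i in atTop, tsupport (shrinkingKernel n i) ⊆ ball 0 r := by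
  have hlim : Tendsto (fun i => (shrinkingBump n i).rOut) atTop (𝓝 0) :=
    tendsto_one_div_add_atTop_nhds_zero_nat
  filter_upwards [hlim.eventually_lt_const hr] with i hi
  exact (tsupport_shrinkingKernel i).trans (closedBall_subset_ball hi)

/-- The density of the pull-back under `f` of the `i`-th bump function centred at `z`. -/
def pulledBackBump (f : (Fin n → ℂ) → (Fin n → ℂ)) (z : Fin n → ℂ) (i : ℕ) (w : Fin n → ℂ) : ℝ :=
  normSq (jacDet f w) * (shrinkingBump n i).normed volume (f w - z)

theorem pulledBackBump_nonneg (i : ℕ) : 0 ≤ pulledBackBump f z i w :=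
  mul_nonneg (normSq_nonneg _) (ContDiffBump.nonneg_normed _ _)

theorem smoothTrace_shrinkingKernel (i : ℕ) :
    smoothTrace f U h (shrinkingKernel n i) z = ∫ w in U, pulledBackBump f z i w • h w := by
  simp only [smoothTrace, shrinkingKernel, pulledBackBump, Complex.mul_conj, real_smul,
    ofReal_mul, mul_assoc, mul_comm]

theorem eventually_normed_shrinkingBump_eq_zero {N : Set (Fin n → ℂ)} (hN : N ∈ 𝓝 z) :
    ∀ᶠ i in atTop, ∀ y ∉ N, (shrinkingBump n i).normed volume (y - z) = 0 := by
  obtain ⟨r, hr, hrN⟩ := Metric.mem_nhds_iff.1 hN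
  filter_upwards [eventually_tsupport_shrinkingKernel_subset_ball hr] with i hi y hy
  by_contra hne
  refine hy (hrN ?_)
  have hmem : y - z ∈ ball 0 r := hi (subset_tsupport _ (by simpa [shrinkingKernel] using hne))
  simpa [dist_eq_norm] using hmem

theorem eventually_pulledBackBump_eq_zero {N : Set (Fin n → ℂ)} (hN : N ∈ 𝓝 z) :
    ∀ᶠ i in atTop, ∀ w, f w ∉ N → pulledBackBump f z i w = 0 := by
  filter_upwards [eventually_normed_shrinkingBump_eq_zero hN] with i hi w hw
  rw [pulledBackBump, hi _ hw, mul_zero]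

theorem eventually_integrableOn_and_setIntegral_pulledBackBump (hV : IsOpen V)
    (hf : DifferentiableOn ℂ f V) (hinj : InjOn f V) (hz : f '' V ∈ 𝓝 z) :
    ∀ᶠ i in atTop, IntegrableOn (pulledBackBump f z i) V ∧
      ∫ w in V, pulledBackBump f z i w = 1 := by
  filter_upwards [eventually_normed_shrinkingBump_eq_zero hz] with i hi
  have hchange := integrableOn_and_setIntegral_normSq_jacDet_mul hV hf hinj
    ((shrinkingBump n i).integrable_normed.comp_sub_right z) hi
  rwa [integral_sub_right_eq_self, ContDiffBump.integral_normed] at hchange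

theorem tendsto_setIntegral_pulledBackBump_smul (hV : IsOpen V) (hV' : volume V ≠ ⊤)
    (hf : DifferentiableOn ℂ f V) (hinj : InjOn f V) (hw : w ∈ V) (hJ : jacDet f w ≠ 0)
    (hh : IntegrableOn h V) (hhw : ContinuousAt h w) :
    (∀ᶠ i in atTop, IntegrableOn (fun y => pulledBackBump f (f w) i y • h y) V) ∧
      Tendsto (fun i => ∫ y in V, pulledBackBump f (f w) i y • h y) atTop (𝓝 (h w)) := by
  have himage : ∀ u ∈ 𝓝 w, f '' u ∈ 𝓝 (f w) := fun u hu =>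
    map_nhds_eq_of_jacDet_ne_zero hV hf hw hJ ▸ image_mem_map hu
  have hmass := eventually_integrableOn_and_setIntegral_pulledBackBump hV hf hinj
    (himage V (hV.mem_nhds hw))
  have hlim : Tendsto (fun i => ∫ y in V, pulledBackBump f (f w) i y) atTop (𝓝 1) :=
    tendsto_const_nhds.congr' (hmass.mono fun i hi => hi.2.symm)
  have hmeas := hmass.mono fun i hi => hi.1.aestronglyMeasurable
  have huniform : ∀ u : Set (Fin n → ℂ), IsOpen u → w ∈ u →
      TendstoUniformlyOn (pulledBackBump f (f w)) 0 atTop (V \ u) := by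
    refine fun u hu hwu => tendstoUniformlyOn_iff.2 fun ε hε => ?_
    filter_upwards [eventually_pulledBackBump_eq_zero (f := f)
      (himage _ (inter_mem (hu.mem_nhds hwu) (hV.mem_nhds hw)))] with i hi y hy
    rw [hi y, Pi.zero_apply, dist_self]
    · exact hε
    · rintro ⟨y', hy', hyy'⟩
      exact hy.2 (hinj hy'.2 hy.1 hyy' ▸ hy'.1)
  have hhlim : Tendsto h (𝓝[V] w) (𝓝 (h w)) := hhw.tendsto.mono_left nhdsWithin_le_nhds
  exact ⟨integrableOn_peak_smul_of_integrableOn_of_tendsto hV.measurableSet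
      self_mem_nhdsWithin huniform hlim hmeas hh hhlim,
    tendsto_setIntegral_peak_smul_of_integrableOn_of_tendsto hV.measurableSet hV.measurableSet
      subset_rfl self_mem_nhdsWithin hV' (Eventually.of_forall fun i y _ => pulledBackBump_nonneg i)
      huniform hlim hmeas hh hhlim⟩

theorem exists_mem_nhds_inter_preimage_subset {X Y : Type*} [TopologicalSpace X]
    [TopologicalSpace Y] [LocallyCompactSpace Y] [T2Space Y] {f : X → Y} {U V : Set X} {G : Set Y}
    (hG : IsOpen G) (hf : ContinuousOn f U)
    (hproper : ∀ C ⊆ G, IsCompact C → IsCompact (U ∩ f ⁻¹' C)) {z : Y} (hz : z ∈ G)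
    (hV : IsOpen V) (hfiber : U ∩ f ⁻¹' {z} ⊆ V) : ∃ N ∈ 𝓝 z, U ∩ f ⁻¹' N ⊆ V := by
  obtain ⟨C, hC, hCG, hCc⟩ := local_compact_nhds (hG.mem_nhds hz)
  have himage : IsCompact (f '' ((U ∩ f ⁻¹' C) \ V)) :=
    ((hproper C hCG hCc).diff hV).image_of_continuousOn (hf.mono fun w hw => hw.1.1)
  refine ⟨C ∩ (f '' ((U ∩ f ⁻¹' C) \ V))ᶜ, inter_mem hC (himage.isClosed.compl_mem_nhds ?_), ?_⟩
  · rintro ⟨w, hw, hwz⟩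
    exact hw.2 (hfiber ⟨hw.1.1, hwz⟩)
  · rintro w ⟨hwU, hwC, hwV⟩
    by_contra hw
    exact hwV ⟨w, ⟨⟨hwU, hwC⟩, hw⟩, rfl⟩

theorem exists_isOpen_subset_injOn_integrableOn (hU : IsOpen U) (hf : DifferentiableOn ℂ f U)
    (hh : ContinuousOn h U) (hw : w ∈ U) (hJ : jacDet f w ≠ 0) {N : Set (Fin n → ℂ)}
    (hN : N ∈ 𝓝 w) :
    ∃ V ⊆ N, IsOpen V ∧ w ∈ V ∧ InjOn f V ∧ IntegrableOn h V ∧ volume V ≠ ⊤ := by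
  obtain ⟨W, hW, hinj⟩ := exists_mem_nhds_injOn_of_jacDet_ne_zero hU hf hw hJ
  obtain ⟨C, hC, hCsub, hCc⟩ :=
    local_compact_nhds (inter_mem (inter_mem hN hW) (hU.mem_nhds hw))
  exact ⟨interior C, fun y hy => (hCsub (interior_subset hy)).1.1, isOpen_interior,
    mem_interior_iff_mem_nhds.2 hC, hinj.mono fun y hy => (hCsub (interior_subset hy)).1.2,
    ((hh.mono fun y hy => (hCsub hy).2).integrableOn_compact hCc).mono_set interior_subset,
    measure_ne_top_of_subset interior_subset hCc.measure_ne_top⟩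

theorem IsProperHolomorphic.tendsto_smoothTrace (hf : IsProperHolomorphic f U G) (hU : IsOpen U)
    (hG : IsOpen G) (hh : ContinuousOn h U) (hz : z ∈ G) (hreg : IsRegularValue f U z) :
    Tendsto (fun i => smoothTrace f U h (shrinkingKernel n i) z) atTop
      (𝓝 (fiberSum f U h z)) := by
  have hfin := hreg.finite_fiber hU hf.1 (hf.2.2 _ (by simpa using hz) isCompact_singleton)
  set S := hfin.toFinset with hS
  have hmemS : ∀ {w}, w ∈ S ↔ w ∈ U ∧ f w = z := by simp [hS]
  obtain ⟨W, hW, hWdisj⟩ := hfin.t2_separation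
  choose! V hVsub hVo hwV hVinj hVint hVfin using fun w (hw : w ∈ S) =>
    exists_isOpen_subset_injOn_integrableOn hU hf.1 hh (hmemS.1 hw).1
      (hreg w (hmemS.1 hw).1 (hmemS.1 hw).2)
      (inter_mem (hU.mem_nhds (hmemS.1 hw).1) ((hW w).2.mem_nhds (hW w).1))
  have hVU : ∀ w ∈ S, V w ⊆ U := fun w hw => (hVsub w hw).trans inter_subset_left
  have hVdisj : (S : Set (Fin n → ℂ)).Pairwise (Function.onFun Disjoint V) :=
    fun a ha b hb hab => (hWdisj (hfin.mem_toFinset.1 ha) (hfin.mem_toFinset.1 hb) hab).mono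
      ((hVsub a ha).trans inter_subset_right) ((hVsub b hb).trans inter_subset_right)
  have hsheet := fun w (hw : w ∈ S) => tendsto_setIntegral_pulledBackBump_smul (hVo w hw)
    (hVfin w hw) (hf.1.mono (hVU w hw)) (hVinj w hw) (hwV w hw)
    (hreg w (hmemS.1 hw).1 (hmemS.1 hw).2) (hVint w hw)
    (hh.continuousAt (hU.mem_nhds (hmemS.1 hw).1))
  obtain ⟨N, hN, hNV⟩ := exists_mem_nhds_inter_preimage_subset hG hf.1.continuousOn hf.2.2 hz
    (V := ⋃ w ∈ S, V w) (isOpen_biUnion hVo) fun w hw =>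
      mem_biUnion (hfin.mem_toFinset.2 hw) (hwV w (hfin.mem_toFinset.2 hw))
  have hsplit : ∀ᶠ i in atTop, ∑ w ∈ S, ∫ y in V w, pulledBackBump f (f w) i y • h y =
      smoothTrace f U h (shrinkingKernel n i) z := by
    filter_upwards [eventually_pulledBackBump_eq_zero (f := f) hN,
      (S.eventually_all).2 fun w hw => (hsheet w hw).1] with i hzero hint
    rw [smoothTrace_shrinkingKernel, setIntegral_eq_of_subset_of_forall_sdiff_eq_zero
      hU.measurableSet (iUnion₂_subset hVU) fun y hy => ?_, integral_biUnion_finset S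
      (fun w hw => (hVo w hw).measurableSet) hVdisj fun w hw => (hmemS.1 hw).2 ▸ hint w hw]
    · exact Finset.sum_congr rfl fun w hw => by rw [(hmemS.1 hw).2]
    · rw [hzero y fun hyN => hy.2 (hNV ⟨hy.1, hyN⟩), zero_smul]
  rw [fiberSum, finsum_mem_eq_finite_toFinset_sum _ hfin]
  exact (tendsto_finsetSum S fun w hw => (hsheet w hw).2).congr' hsplit

end RegularValues

noncomputable section FiberTrace

open Filter Topology Metric Set MeasureTheory Complex
open scoped ComplexConjugate

theorem eq_of_differentiableOn_of_im_eq_zero {E : Type*} [NormedAddCommGroup E] [NormedSpace ℂ E]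
    {T : E → ℂ} {s : Set E} (hs : IsOpen s) (hs' : IsPreconnected s)
    (hT : DifferentiableOn ℂ T s) (him : ∀ z ∈ s, (T z).im = 0) {x y : E} (hx : x ∈ s)
    (hy : y ∈ s) : T x = T y := by
  refine hs.is_const_of_fderiv_eq_zero (𝕜 := ℂ) hs' hT (fun z hz => ?_) hx hy
  have hderiv : HasFDerivAt (fun z => (T z).im)
      (Complex.imCLM ∘L (fderiv ℂ T z).restrictScalars ℝ) z :=
    Complex.imCLM.hasFDerivAt.comp z
      ((hT.differentiableAt (hs.mem_nhds hz)).hasFDerivAt.restrictScalars ℝ)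
  have hzero : HasFDerivAt (fun z => (T z).im) (0 : E →L[ℝ] ℝ) z :=
    (hasFDerivAt_const 0 z).congr_of_eventuallyEq (eventually_of_mem (hs.mem_nhds hz) him)
  have him' : ∀ v, (fderiv ℂ T z v).im = 0 := fun v => by
    simpa using DFunLike.congr_fun (hderiv.unique hzero) v
  ext v
  refine Complex.ext ?_ (by simpa using him' v)
  simpa using him' (I • v)

theorem cauchySeq_of_forall_exists_cauchySeq_dist_le {X : Type*} [PseudoMetricSpace X] {u : ℕ → X}
    (h : ∀ ε > 0, ∃ v : ℕ → X, CauchySeq v ∧ ∀ᶠ i in atTop, dist (u i) (v i) ≤ ε) :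
    CauchySeq u := by
  refine Metric.cauchySeq_iff'.2 fun ε hε => ?_
  obtain ⟨v, hv, huv⟩ := h (ε / 4) (by positivity)
  obtain ⟨N₁, hN₁⟩ := eventually_atTop.1 huv
  obtain ⟨N₂, hN₂⟩ := Metric.cauchySeq_iff.1 hv (ε / 4) (by positivity)
  refine ⟨max N₁ N₂, fun i hi => ?_⟩
  have hi₁ := hN₁ i ((le_max_left _ _).trans hi)
  have hi₂ := hN₂ i ((le_max_right _ _).trans hi) _ (le_max_right N₁ N₂)
  have hN := hN₁ _ (le_max_left N₁ N₂)
  linarith [dist_triangle4_right (u i) (u (max N₁ N₂)) (v i) (v (max N₁ N₂))]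

variable {n : ℕ} {f : (Fin n → ℂ) → (Fin n → ℂ)} {h : (Fin n → ℂ) → ℂ}
  {U G : Set (Fin n → ℂ)} {z : Fin n → ℂ}

theorem dense_setOf_isRegularValue (hU : IsOpen U) (hf : DifferentiableOn ℂ f U) :
    Dense {z | IsRegularValue f U z} := by
  have hsard : volume (f '' {w ∈ U | jacDet f w = 0}) = 0 := by
    refine addHaar_image_eq_zero_of_det_fderivWithin_eq_zero volume
      (f' := fun w => (fderiv ℂ f w).restrictScalars ℝ) (fun w hw => ?_) fun w hw => ?_
    · exact ((hf.differentiableAt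
        (hU.mem_nhds hw.1)).hasFDerivAt.restrictScalars ℝ).hasFDerivWithinAt
    · rw [← abs_eq_zero, abs_det_restrictScalars]
      exact (map_eq_zero normSq).2 hw.2
  refine Measure.dense_of_ae (μ := volume) ?_
  filter_upwards [measure_eq_zero_iff_ae_notMem.1 hsard] with z hz w hw hwz hJ
  exact hz ⟨w, ⟨hw, hJ⟩, hwz⟩

theorem IsProperHolomorphic.finite_fiber (hf : IsProperHolomorphic f U G) (hU : IsOpen U)
    (hz : z ∈ G) (hreg : IsRegularValue f U z) : (U ∩ f ⁻¹' {z}).Finite :=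
  hreg.finite_fiber hU hf.1 (hf.2.2 _ (by simpa using hz) isCompact_singleton)

theorem smoothTrace_one_shrinkingKernel (i : ℕ) :
    smoothTrace f U 1 (shrinkingKernel n i) z = (∫ w in U, pulledBackBump f z i w : ℝ) := by
  rw [smoothTrace_shrinkingKernel, ← integral_complex_ofReal]
  simp only [Pi.one_apply, real_smul, mul_one]

theorem norm_smoothTrace_le {K : Set (Fin n → ℂ)} {M : ℝ} {i : ℕ} (hU : IsOpen U)
    (hf : DifferentiableOn ℂ f U) (hK : IsCompact K) (hKU : K ⊆ U)
    (hsupp : ∀ w ∈ U, f w - z ∈ tsupport (shrinkingKernel n i) → w ∈ K)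
    (hM : ∀ w ∈ K, ‖h w‖ ≤ M) :
    ‖smoothTrace f U h (shrinkingKernel n i) z‖ ≤
      M * ‖smoothTrace f U 1 (shrinkingKernel n i) z‖ := by
  have hzero : ∀ w ∈ U, w ∉ K → pulledBackBump f z i w = 0 := fun w hw hwK => by
    have hkernel := image_eq_zero_of_notMem_tsupport fun hmem => hwK (hsupp w hw hmem)
    rw [pulledBackBump, ofReal_eq_zero.1 hkernel, mul_zero]
  have hcont : ContinuousOn (pulledBackBump f z i) K :=
    (Complex.continuous_normSq.comp_continuousOn
      ((differentiableOn_jacDet hU hf).continuousOn.mono hKU)).mul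
    ((ContDiffBump.continuous_normed _).comp_continuousOn
      ((hf.continuousOn.mono hKU).sub continuousOn_const))
  have hint : IntegrableOn (pulledBackBump f z i) U :=
    (hcont.integrableOn_compact hK).of_forall_sdiff_eq_zero hU.measurableSet
      fun w hw => hzero w hw.1 hw.2
  rw [smoothTrace_one_shrinkingKernel, norm_real,
    Real.norm_of_nonneg (integral_nonneg fun w => pulledBackBump_nonneg i),
    smoothTrace_shrinkingKernel, ← integral_const_mul]
  refine norm_integral_le_of_norm_le (hint.const_mul M) ?_
  filter_upwards [ae_restrict_mem hU.measurableSet] with w hw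
  rw [norm_smul, Real.norm_of_nonneg (pulledBackBump_nonneg i), mul_comm]
  by_cases hwK : w ∈ K
  · exact mul_le_mul_of_nonneg_right (hM w hwK) (pulledBackBump_nonneg i)
  · simp [hzero w hw hwK]

namespace IsProperHolomorphic

section

variable (hf : IsProperHolomorphic f U G) (hU : IsOpen U) (hG : IsOpen G)

include hf hG in
theorem exists_isCompact_eventually_mem (hz : z ∈ G) :
    ∃ r > 0, ball z r ⊆ G ∧ ∃ K ⊆ U, IsCompact K ∧ ∀ᶠ i in atTop, ∀ y ∈ ball z r, ∀ w ∈ U,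
      f w - y ∈ tsupport (shrinkingKernel n i) → w ∈ K := by
  obtain ⟨ρ, hρ, hρG⟩ := Metric.nhds_basis_closedBall.mem_iff.1 (hG.mem_nhds hz)
  refine ⟨ρ / 2, by positivity, ((ball_subset_ball (by linarith)).trans
    ball_subset_closedBall).trans hρG, U ∩ f ⁻¹' closedBall z ρ, inter_subset_left,
    hf.2.2 _ hρG (isCompact_closedBall _ _), ?_⟩
  filter_upwards [eventually_tsupport_shrinkingKernel_subset_ball (half_pos hρ)]
    with i hi y hy w hw hmem
  have hwy := mem_ball_zero_iff.1 (hi hmem)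
  rw [← dist_eq_norm] at hwy
  refine ⟨hw, mem_closedBall.2 ?_⟩
  linarith [dist_triangle (f w) y z, mem_ball.1 hy]

include hf hU hG

theorem exists_eventually_norm_smoothTrace_le (hh : DifferentiableOn ℂ h U) (hz : z ∈ G) :
    ∃ r > 0, ball z r ⊆ G ∧ ∃ M, ∀ᶠ i in atTop,
      DifferentiableOn ℂ (smoothTrace f U h (shrinkingKernel n i)) (ball z r) ∧
        ∀ y ∈ ball z r, ‖smoothTrace f U h (shrinkingKernel n i) y‖ ≤ M := by
  obtain ⟨r, hr, hrG, K, hKU, hK, hsupp⟩ := hf.exists_isCompact_eventually_mem hG hz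
  obtain ⟨M, hM⟩ := hK.exists_bound_of_continuousOn (hh.continuousOn.mono hKU)
  obtain ⟨z₁, hreg, hz₁⟩ := (dense_setOf_isRegularValue hU hf.1).exists_mem_open isOpen_ball
    ⟨z, mem_ball_self hr⟩
  have hone : DifferentiableOn ℂ (1 : (Fin n → ℂ) → ℂ) U := differentiableOn_const 1
  have hlim := (hf.tendsto_smoothTrace hU hG hone.continuousOn (hrG hz₁) hreg).norm
  refine ⟨r, hr, hrG, max M 0 * (‖fiberSum f U 1 z₁‖ + 1), ?_⟩
  filter_upwards [hsupp, hlim.eventually_le_const (lt_add_one _)] with i hi hle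
  have hdiff : ∀ {p : (Fin n → ℂ) → ℂ}, DifferentiableOn ℂ p U →
      DifferentiableOn ℂ (smoothTrace f U p (shrinkingKernel n i)) (ball z r) := fun hp =>
    differentiableOn_smoothTrace hU hf.1 hp (contDiff_shrinkingKernel i)
      (hasCompactSupport_shrinkingKernel i) hK hKU isOpen_ball hi
  refine ⟨hdiff hh, fun y hy => ?_⟩
  have hconst : smoothTrace f U 1 (shrinkingKernel n i) y =
      smoothTrace f U 1 (shrinkingKernel n i) z₁ :=
    eq_of_differentiableOn_of_im_eq_zero isOpen_ball (convex_ball _ _).isPreconnected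
      (hdiff hone)
      (fun x _ => by rw [smoothTrace_one_shrinkingKernel, ofReal_im]) hy hz₁
  calc ‖smoothTrace f U h (shrinkingKernel n i) y‖
      ≤ max M 0 * ‖smoothTrace f U 1 (shrinkingKernel n i) y‖ :=
        norm_smoothTrace_le hU hf.1 hK hKU (hi y hy)
          fun w hw => (hM w hw).trans (le_max_left _ _)
    _ ≤ max M 0 * (‖fiberSum f U 1 z₁‖ + 1) := by
        rw [hconst]
        gcongr

theorem cauchySeq_smoothTrace (hh : DifferentiableOn ℂ h U) (hz : z ∈ G) :
    CauchySeq fun i => smoothTrace f U h (shrinkingKernel n i) z := by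
  obtain ⟨r, hr, hrG, M, hM⟩ := hf.exists_eventually_norm_smoothTrace_le hU hG hh hz
  rw [← mul_div_cancel₀ r three_ne_zero] at hrG hM
  have hz' : z ∈ ball z (r / 3) := mem_ball_self (by positivity)
  refine cauchySeq_of_forall_exists_cauchySeq_dist_le fun ε hε => ?_
  have hclose : ∀ᶠ y in 𝓝 z, M / (r / 3) * dist z y < ε := by
    have hcont : Tendsto (fun y => M / (r / 3) * dist z y) (𝓝 z) (𝓝 0) := by
      simpa using (show Continuous fun y => M / (r / 3) * dist z y by fun_prop).tendsto z
    exact hcont.eventually_lt_const hε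
  obtain ⟨y, hreg, hyε, hyr⟩ := (dense_setOf_isRegularValue hU hf.1).inter_nhds_nonempty
    (inter_mem hclose (isOpen_ball.mem_nhds hz'))
  refine ⟨_, (hf.tendsto_smoothTrace hU hG hh.continuousOn
    (hrG (ball_subset_ball (by linarith) hyr)) hreg).cauchySeq, ?_⟩
  filter_upwards [hM] with i hi
  exact (dist_le_mul_dist_of_norm_le hi.1 hi.2 hz' hyr).trans (le_of_lt hyε)

end

end IsProperHolomorphic

/-- The trace of `h` along the restriction of `f` to `U`: the limit of its smoothed traces. For
proper `f` it is the holomorphic function whose value at a regular value is `fiberSum`. -/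
def fiberTrace (f : (Fin n → ℂ) → (Fin n → ℂ)) (U : Set (Fin n → ℂ)) (h : (Fin n → ℂ) → ℂ)
    (z : Fin n → ℂ) : ℂ :=
  limUnder atTop fun i => smoothTrace f U h (shrinkingKernel n i) z

namespace IsProperHolomorphic

variable (hf : IsProperHolomorphic f U G) (hU : IsOpen U) (hG : IsOpen G)

include hf hU hG

theorem tendsto_fiberTrace (hh : DifferentiableOn ℂ h U) (hz : z ∈ G) :
    Tendsto (fun i => smoothTrace f U h (shrinkingKernel n i) z) atTop
      (𝓝 (fiberTrace f U h z)) :=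
  (hf.cauchySeq_smoothTrace hU hG hh hz).tendsto_limUnder

theorem fiberTrace_eq_fiberSum (hh : ContinuousOn h U) (hz : z ∈ G)
    (hreg : IsRegularValue f U z) : fiberTrace f U h z = fiberSum f U h z :=
  (hf.tendsto_smoothTrace hU hG hh hz hreg).limUnder_eq

theorem differentiableOn_fiberTrace (hh : DifferentiableOn ℂ h U) :
    DifferentiableOn ℂ (fiberTrace f U h) G := fun _ hz =>
  let ⟨_, hr, hrG, _, hM⟩ := hf.exists_eventually_norm_smoothTrace_le hU hG hh hz
  (differentiableAt_of_tendsto_of_norm_le hr (hM.mono fun _ hi => hi.1) (hM.mono fun _ hi => hi.2)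
    fun _ hy => hf.tendsto_fiberTrace hU hG hh (hrG hy)).differentiableWithinAt

theorem ncard_fiber_eq (hG' : IsPreconnected G) {x y : Fin n → ℂ} (hx : x ∈ G)
    (hxr : IsRegularValue f U x) (hy : y ∈ G) (hyr : IsRegularValue f U y) :
    (U ∩ f ⁻¹' {x}).ncard = (U ∩ f ⁻¹' {y}).ncard := by
  have hone : DifferentiableOn ℂ (1 : (Fin n → ℂ) → ℂ) U := differentiableOn_const 1
  have htrace : ∀ {z}, z ∈ G → IsRegularValue f U z →
      fiberTrace f U 1 z = (U ∩ f ⁻¹' {z}).ncard := fun hz hreg => by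
    have hfin := hf.finite_fiber hU hz hreg
    rw [hf.fiberTrace_eq_fiberSum hU hG hone.continuousOn hz hreg, fiberSum,
      finsum_mem_eq_finite_toFinset_sum _ hfin, ncard_eq_toFinset_card _ hfin]
    simp
  have hreal : ∀ z ∈ G, (fiberTrace f U 1 z).im = 0 := fun z hz =>
    (tendsto_nhds_unique ((Complex.continuous_im.tendsto _).comp
      (hf.tendsto_fiberTrace hU hG hone hz))
      (tendsto_const_nhds.congr fun i => by
        simp [smoothTrace_one_shrinkingKernel]) : _ = (0 : ℝ))
  have heq := eq_of_differentiableOn_of_im_eq_zero hG hG'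
    (hf.differentiableOn_fiberTrace hU hG hone) hreal hx hy
  rw [htrace hx hxr, htrace hy hyr] at heq
  exact_mod_cast heq

end IsProperHolomorphic

end FiberTrace

noncomputable section Openness

open Filter Topology Metric Set Complex

section

variable {n : ℕ} {f : (Fin n → ℂ) → (Fin n → ℂ)} {U V G : Set (Fin n → ℂ)}
  {w₀ z₀ : Fin n → ℂ}

theorem exists_isRegularValue_mem_image_of_jacDet_ne_zero (hU : IsOpen U)
    (hf : DifferentiableOn ℂ f U) (hw₀ : w₀ ∈ U) (hJ : jacDet f w₀ ≠ 0) (hV : V ∈ 𝓝 w₀) :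
    ∃ w ∈ V, IsRegularValue f U (f w) := by
  have hfV : f '' V ∈ 𝓝 (f w₀) := map_nhds_eq_of_jacDet_ne_zero hU hf hw₀ hJ ▸ image_mem_map hV
  obtain ⟨-, hreg, w, hw, rfl⟩ := (dense_setOf_isRegularValue hU hf).inter_nhds_nonempty hfV
  exact ⟨w, hw, hreg⟩

theorem IsProperHolomorphic.subset_image_of_jacDet_ne_zero (hf : IsProperHolomorphic f U G)
    (hU : IsOpen U) (hG : IsOpen G) (hGc : IsPreconnected G) (hw₀ : w₀ ∈ U)
    (hJ : jacDet f w₀ ≠ 0) : G ⊆ f '' U := by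
  intro z hz
  by_contra hzf
  obtain ⟨w, hw, hreg⟩ :=
    exists_isRegularValue_mem_image_of_jacDet_ne_zero hU hf.1 hw₀ hJ (hU.mem_nhds hw₀)
  obtain ⟨N, hN, hNU⟩ := exists_mem_nhds_inter_preimage_subset hG hf.1.continuousOn hf.2.2 hz
    isOpen_empty fun y hy => hzf ⟨y, hy⟩
  obtain ⟨z', hreg', hz'N, hz'G⟩ := (dense_setOf_isRegularValue hU hf.1).inter_nhds_nonempty
    (inter_mem hN (hG.mem_nhds hz))
  have hempty : U ∩ f ⁻¹' {z'} = ∅ := subset_empty_iff.1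
    ((inter_subset_inter_right U (preimage_mono (singleton_subset_iff.2 hz'N))).trans hNU)
  have hcard := hf.ncard_fiber_eq hU hG hGc (hf.2.1 hw) hreg hz'G hreg'
  rw [hempty, ncard_empty, ncard_eq_zero (hf.finite_fiber hU (hf.2.1 hw) hreg)] at hcard
  exact hcard.subset ⟨hw, rfl⟩

theorem eventually_jacDet_add_smul_ne_zero (hf : DifferentiableAt ℂ f w₀) :
    ∀ᶠ s in 𝓝[≠] (0 : ℂ), jacDet (fun w => f w + s • w) w₀ ≠ 0 := by
  set P := LinearMap.charpoly (-(fderiv ℂ f w₀ : (Fin n → ℂ) →ₗ[ℂ] (Fin n → ℂ)))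
  have hP : P ≠ 0 := (LinearMap.charpoly_monic _).ne_zero
  have hroots : ({s : ℂ | P.IsRoot s} \ {0})ᶜ ∈ 𝓝 (0 : ℂ) :=
    ((Polynomial.finite_setOfPred_isRoot hP).subset
      sdiff_subset).isClosed.isOpen_compl.mem_nhds (by simp)
  filter_upwards [mem_nhdsWithin_of_mem_nhds hroots, self_mem_nhdsWithin] with s hs hs0 hJ
  refine hs ⟨?_, hs0⟩
  have hd : fderiv ℂ (fun w => f w + s • w) w₀ =
      fderiv ℂ f w₀ + s • ContinuousLinearMap.id ℂ (Fin n → ℂ) :=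
    (hf.hasFDerivAt.add ((hasFDerivAt_id w₀).const_smul s)).fderiv
  change P.eval s = 0
  rw [LinearMap.eval_charpoly, ← hJ, jacDet, hd, ContinuousLinearMap.det]
  congr 1
  ext v i
  simp [add_comm]

end

section Perturbation

variable {E : Type*} [NormedAddCommGroup E] [NormedSpace ℂ E] {f : E → E} {U G : Set E} {z₀ : E}
  {r : ℝ}

theorem IsProperHolomorphic.add_smul (hf : IsProperHolomorphic f U G) [ProperSpace E] {M : ℝ}
    (hrG : closedBall z₀ (2 * r) ⊆ G) (hM : ∀ w ∈ U ∩ f ⁻¹' closedBall z₀ (2 * r), ‖w‖ ≤ M)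
    {s : ℂ} (hs : ‖s‖ * M < r) :
    IsProperHolomorphic (fun w => f w + s • w)
      (U ∩ f ⁻¹' ball z₀ (2 * r) ∩ (fun w => f w + s • w) ⁻¹' ball z₀ r) (ball z₀ r) := by
  set K := U ∩ f ⁻¹' closedBall z₀ (2 * r)
  have hK : IsCompact K := hf.2.2 _ hrG (isCompact_closedBall _ _)
  have hdiff : DifferentiableOn ℂ (fun w => f w + s • w) U :=
    hf.1.add (differentiableOn_id.const_smul s)
  refine ⟨hdiff.mono fun w hw => hw.1.1, fun w hw => hw.2, fun C hC hCc => ?_⟩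
  have hpre : U ∩ f ⁻¹' ball z₀ (2 * r) ∩ (fun w => f w + s • w) ⁻¹' ball z₀ r ∩
      (fun w => f w + s • w) ⁻¹' C = K ∩ (fun w => f w + s • w) ⁻¹' C := by
    refine Subset.antisymm
      (fun w hw => ⟨⟨hw.1.1.1, ball_subset_closedBall hw.1.1.2⟩, hw.2⟩)
      fun w ⟨hwK, hwC⟩ => ⟨⟨⟨hwK.1, ?_⟩, hC hwC⟩, hwC⟩
    have hdist : dist (f w) (f w + s • w) ≤ ‖s‖ * M := by
      rw [dist_self_add_right, norm_smul]
      exact mul_le_mul_of_nonneg_left (hM w hwK) (norm_nonneg s)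
    exact mem_ball.2 (by
      linarith [dist_triangle (f w) (f w + s • w) z₀, mem_ball.1 (hC hwC)])
  rw [hpre]
  exact hK.of_isClosed_subset ((hdiff.continuousOn.mono
    inter_subset_left).preimage_isClosed_of_isClosed hK.isClosed hCc.isClosed) inter_subset_left

theorem IsProperHolomorphic.restrict_connectedComponentIn (hf : IsProperHolomorphic f U G) (c : E) :
    IsProperHolomorphic f (connectedComponentIn U c) G := by
  have hsub := connectedComponentIn_subset U c
  refine ⟨hf.1.mono hsub, hf.2.1.mono_left hsub, fun C hC hCc => ?_⟩
  have hclosed : U ∩ closure (connectedComponentIn U c) ⊆ connectedComponentIn U c := by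
    rintro x ⟨hxU, hx⟩
    have hne : c ∈ connectedComponentIn U c := by
      obtain ⟨y, hy⟩ := closure_nonempty_iff.1 ⟨x, hx⟩
      exact mem_connectedComponentIn ((connectedComponentIn_nonempty_iff.1 ⟨y, hy⟩))
    exact (isPreconnected_connectedComponentIn.subset_closure (subset_insert x _)
      (insert_subset hx subset_closure)).subset_connectedComponentIn
      (mem_insert_of_mem x hne) (insert_subset hxU hsub) (mem_insert x _)
  have hpre : connectedComponentIn U c ∩ f ⁻¹' C =
      U ∩ f ⁻¹' C ∩ closure (connectedComponentIn U c) :=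
    Subset.antisymm (fun x hx => ⟨⟨hsub hx.1, hx.2⟩, subset_closure hx.1⟩)
      fun x hx => ⟨hclosed ⟨hx.1.1, hx.2⟩, hx.1.2⟩
  rw [hpre]
  exact (hf.2.2 C hC hCc).inter_right isClosed_closure

theorem exists_eq_of_eventually_exists_add_smul_eq {K : Set E} (hK : IsCompact K)
    (hf : ContinuousOn f K) {z : E} (h : ∀ᶠ s in 𝓝[≠] (0 : ℂ), ∃ w ∈ K, f w + s • w = z) :
    ∃ w ∈ K, f w = z := by
  obtain ⟨g, hg⟩ := h.choice
  let u : Ultrafilter ℂ := Ultrafilter.of (𝓝[≠] (0 : ℂ))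
  have hu : (u : Filter ℂ) ≤ 𝓝[≠] 0 := Ultrafilter.of_le _
  have hgK : ∀ᶠ s in u, g s ∈ K := hu (hg.mono fun s hs => hs.1)
  obtain ⟨w, hwK, hgw⟩ := hK.ultrafilter_le_nhds (u.map g) (le_principal_iff.2 hgK)
  have hlim : Tendsto (fun s => f (g s) + s • g s) u (𝓝 (f w + (0 : ℂ) • w)) :=
    ((hf w hwK).tendsto.comp (tendsto_nhdsWithin_iff.2 ⟨hgw, hgK⟩)).add
      ((tendsto_id'.2 (hu.trans nhdsWithin_le_nhds)).smul hgw)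
  have hconst : Tendsto (fun s => f (g s) + s • g s) u (𝓝 z) :=
    tendsto_const_nhds.congr' (hu (hg.mono fun s hs => hs.2.symm))
  exact ⟨w, hwK, by simpa using tendsto_nhds_unique hlim hconst⟩

end Perturbation

variable {n : ℕ} {f : (Fin n → ℂ) → (Fin n → ℂ)} {U V G : Set (Fin n → ℂ)}
  {w₀ : Fin n → ℂ}

/- Perturbing `f` to `f + s • id` makes the Jacobian determinant at `w₀` nonzero, so that the
perturbed maps cover a ball of fixed radius; compactness passes this on to `f`. -/
theorem IsProperHolomorphic.image_mem_nhds (hf : IsProperHolomorphic f U G) (hU : IsOpen U)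
    (hG : IsOpen G) (hw₀ : w₀ ∈ U) : f '' U ∈ 𝓝 (f w₀) := by
  obtain ⟨ρ, hρ, hρG⟩ := Metric.nhds_basis_closedBall.mem_iff.1 (hG.mem_nhds (hf.2.1 hw₀))
  obtain ⟨r, rfl⟩ : ∃ r, ρ = 2 * r := ⟨ρ / 2, by ring⟩
  have hr : 0 < r := by linarith
  set K := U ∩ f ⁻¹' closedBall (f w₀) (2 * r)
  have hK : IsCompact K := hf.2.2 _ hρG (isCompact_closedBall _ _)
  have hw₀K : w₀ ∈ K := ⟨hw₀, mem_closedBall_self hρ.le⟩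
  obtain ⟨M, hM⟩ := hK.exists_bound_of_continuousOn continuousOn_id
  have hsmall : ∀ᶠ s in 𝓝[≠] (0 : ℂ), ‖s‖ * M < r := by
    have hcont : Tendsto (fun s : ℂ => ‖s‖ * M) (𝓝 0) (𝓝 0) := by
      simpa using (show Continuous fun s : ℂ => ‖s‖ * M by fun_prop).tendsto 0
    exact (hcont.mono_left nhdsWithin_le_nhds).eventually_lt_const hr
  refine mem_of_superset (ball_mem_nhds (f w₀) hr) fun z hz => ?_
  suffices ∃ w ∈ K, f w = z from this.imp fun w hw => ⟨hw.1.1, hw.2⟩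
  refine exists_eq_of_eventually_exists_add_smul_eq hK
    (hf.1.continuousOn.mono inter_subset_left) ?_
  filter_upwards [hsmall, eventually_jacDet_add_smul_ne_zero
    (hf.1.differentiableAt (hU.mem_nhds hw₀))] with s hs hJ
  have hopen : IsOpen (U ∩ f ⁻¹' ball (f w₀) (2 * r) ∩
      (fun w => f w + s • w) ⁻¹' ball (f w₀) r) :=
    ((hf.1.continuousOn.add (continuousOn_id.const_smul s)).mono
      inter_subset_left).isOpen_inter_preimage
      (hf.1.continuousOn.isOpen_inter_preimage hU isOpen_ball) isOpen_ball
  have hw₀s : f w₀ + s • w₀ ∈ ball (f w₀) r := by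
    rw [mem_ball, dist_self_add_left, norm_smul]
    exact (mul_le_mul_of_nonneg_left (hM w₀ hw₀K) (norm_nonneg s)).trans_lt hs
  obtain ⟨w, hw, hwz⟩ := (hf.add_smul hρG hM hs).subset_image_of_jacDet_ne_zero hopen isOpen_ball
    (convex_ball _ r).isPreconnected ⟨⟨hw₀, mem_ball_self hρ⟩, hw₀s⟩ hJ hz
  exact ⟨w, ⟨hw.1.1, ball_subset_closedBall hw.1.2⟩, hwz⟩

theorem IsProperHolomorphic.exists_jacDet_ne_zero (hf : IsProperHolomorphic f U G)
    (hU : IsOpen U) (hG : IsOpen G) (hne : U.Nonempty) : ∃ w ∈ U, jacDet f w ≠ 0 := by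
  obtain ⟨w₀, hw₀⟩ := hne
  obtain ⟨-, hreg, w, hw, rfl⟩ := (dense_setOf_isRegularValue hU hf.1).inter_nhds_nonempty
    (hf.image_mem_nhds hU hG hw₀)
  exact ⟨w, hw, hreg w hw rfl⟩

theorem IsProperHolomorphic.subset_image (hf : IsProperHolomorphic f U G) (hU : IsOpen U)
    (hG : IsOpen G) (hGc : IsPreconnected G) (hne : U.Nonempty) : G ⊆ f '' U := by
  obtain ⟨w, hw, hJ⟩ := hf.exists_jacDet_ne_zero hU hG hne
  exact hf.subset_image_of_jacDet_ne_zero hU hG hGc hw hJ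

theorem IsProperHolomorphic.exists_mem_isRegularValue (hf : IsProperHolomorphic f U G)
    (hU : IsOpen U) (hG : IsOpen G) (hV : IsOpen V) (hVU : V ⊆ U) (hne : V.Nonempty) :
    ∃ w ∈ V, IsRegularValue f U (f w) := by
  obtain ⟨c, hc⟩ := hne
  set U' := connectedComponentIn U c
  have hU' : IsOpen U' := hU.connectedComponentIn
  have hcU' : c ∈ U' := mem_connectedComponentIn (hVU hc)
  obtain ⟨w, hw, hJ⟩ := (hf.restrict_connectedComponentIn c).exists_jacDet_ne_zero hU' hG ⟨c, hcU'⟩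
  obtain ⟨v, hv, hJv⟩ : ∃ v ∈ V, jacDet f v ≠ 0 := by
    by_contra! hzero
    exact hJ (eqOn_zero_of_differentiableOn_of_eventuallyEq_zero hU'
      isPreconnected_connectedComponentIn
      ((differentiableOn_jacDet hU hf.1).mono (connectedComponentIn_subset U c)) hcU'
      (eventually_of_mem (hV.mem_nhds hc) hzero) hw)
  exact exists_isRegularValue_mem_image_of_jacDet_ne_zero hU hf.1 (hVU hv) hJv (hV.mem_nhds hv)

end Openness

noncomputable section FiberTuples

open Filter Topology Metric Set Complex

section Interpolation

variable {E : Type*} [NormedAddCommGroup E] [NormedSpace ℂ E]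

theorem exists_differentiable_eq_one_eqOn_zero {P : Finset E} {a : E} (ha : a ∉ P) :
    ∃ p : E → ℂ, Differentiable ℂ p ∧ p a = 1 ∧ EqOn p 0 P := by
  have hsep : ∀ b ∈ P, ∃ φ : StrongDual ℂ E, φ (a - b) = 1 := fun b hb =>
    SeparatingDual.exists_eq_one (sub_ne_zero.2 (ne_of_mem_of_not_mem hb ha).symm)
  choose! φ hφ using hsep
  refine ⟨fun w => ∏ b ∈ P, φ b (w - b), fun w => ?_, Finset.prod_eq_one hφ,
    fun b hb => Finset.prod_eq_zero (Finset.mem_coe.1 hb) (by simp)⟩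
  classical
  exact (HasFDerivAt.finsetProd (g := fun b w => φ b (w - b)) fun b _ =>
    ((φ b).differentiableAt.comp w (differentiableAt_id.sub_const b)).hasFDerivAt).differentiableAt

theorem sum_eq_of_forall_differentiable {ι : Type*} [Fintype ι] {s t : ι → E}
    (H : ∀ p : E → ℂ, Differentiable ℂ p → ∑ j, p (s j) = ∑ j, p (t j)) (h : E → ℂ) :
    ∑ j, h (s j) = ∑ j, h (t j) := by
  classical
  set P := Finset.univ.image s ∪ Finset.univ.image t
  choose p hp hpa hpP using fun a => exists_differentiable_eq_one_eqOn_zero (P.notMem_erase a)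
  have hinterp : ∀ w ∈ P, ∑ a ∈ P, h a * p a w = h w := fun w hw => by
    rw [Finset.sum_eq_single_of_mem w hw fun a _ haw => ?_, hpa, mul_one]
    rw [hpP a (Finset.mem_coe.2 (Finset.mem_erase.2 ⟨haw.symm, hw⟩)), Pi.zero_apply, mul_zero]
  have heq := H (fun w => ∑ a ∈ P, h a * p a w)
    (Differentiable.fun_sum fun a _ => (hp a).const_mul (h a))
  rwa [Finset.sum_congr rfl fun j _ => hinterp (s j) (by simp [P]),
    Finset.sum_congr rfl fun j _ => hinterp (t j) (by simp [P])] at heq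

theorem exists_eq_of_forall_sum_eq {ι E : Type*} [Fintype ι] {s t : ι → E}
    (H : ∀ h : E → ℂ, ∑ j, h (s j) = ∑ j, h (t j)) (j : ι) : ∃ i, s i = t j := by
  classical
  by_contra! hne
  have hcount := H fun x => if x = t j then 1 else 0
  rw [Finset.sum_eq_zero fun i _ => if_neg (hne i), Finset.sum_boole, eq_comm,
    Nat.cast_eq_zero, Finset.card_eq_zero, Finset.filter_eq_empty_iff] at hcount
  exact hcount (Finset.mem_univ j) rfl

end Interpolation

variable {n m : ℕ} {f : (Fin n → ℂ) → (Fin n → ℂ)} {U G L : Set (Fin n → ℂ)}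
  {t : (Fin n → ℂ) → Fin m → (Fin n → ℂ)} {h : (Fin n → ℂ) → ℂ} {z : Fin n → ℂ}

/-- The fibres of `f : U → G` over regular values have exactly `m` points. -/
def HasDegree (f : (Fin n → ℂ) → (Fin n → ℂ)) (U G : Set (Fin n → ℂ)) (m : ℕ) : Prop :=
  ∀ z ∈ G, IsRegularValue f U z → (U ∩ f ⁻¹' {z}).ncard = m

/-- `t` enumerates, with multiplicities, the fibres of `f : U → G`: the points of `t z` lie in the
fibre over `z`, and the multiplicities are those for which the sums of a holomorphic function over
the points of `t z` form its trace. -/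
structure IsFiberTuple (f : (Fin n → ℂ) → (Fin n → ℂ)) (U G : Set (Fin n → ℂ))
    (t : (Fin n → ℂ) → Fin m → (Fin n → ℂ)) : Prop where
  mem : ∀ z ∈ G, ∀ j, t z j ∈ U ∩ f ⁻¹' {z}
  sum_eq : ∀ z ∈ G, ∀ p, DifferentiableOn ℂ p U → ∑ j, p (t z j) = fiberTrace f U p z

theorem inter_preimage_inter_preimage_of_subset {X Y : Type*} {f : X → Y} {U : Set X}
    {L C : Set Y} (hC : C ⊆ L) : U ∩ f ⁻¹' L ∩ f ⁻¹' C = U ∩ f ⁻¹' C := by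
  rw [inter_assoc, ← preimage_inter, inter_eq_right.2 hC]

theorem IsProperHolomorphic.restrict_preimage {V W : Type*} [NormedAddCommGroup V]
    [NormedSpace ℂ V] [NormedAddCommGroup W] [NormedSpace ℂ W] {f : V → W} {U : Set V}
    {G L : Set W} (hf : IsProperHolomorphic f U G) (hLG : L ⊆ G) :
    IsProperHolomorphic f (U ∩ f ⁻¹' L) L :=
  ⟨hf.1.mono inter_subset_left, fun _ hw => hw.2, fun C hC hCc => by
    rw [inter_preimage_inter_preimage_of_subset hC]
    exact hf.2.2 C (hC.trans hLG) hCc⟩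

theorem isRegularValue_inter_preimage (hz : z ∈ L) :
    IsRegularValue f (U ∩ f ⁻¹' L) z ↔ IsRegularValue f U z :=
  ⟨fun hreg w hw hwz => hreg w ⟨hw, by rwa [mem_preimage, hwz]⟩ hwz,
    fun hreg w hw => hreg w hw.1⟩

theorem HasDegree.restrict_preimage (hm : HasDegree f U G m) (hLG : L ⊆ G) :
    HasDegree f (U ∩ f ⁻¹' L) L m := fun z hz hreg => by
  rw [inter_preimage_inter_preimage_of_subset (singleton_subset_iff.2 hz)]
  exact hm z (hLG hz) ((isRegularValue_inter_preimage hz).1 hreg)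

theorem fiberSum_eq_sum {s : Fin m → (Fin n → ℂ)} (hs : Function.Injective s)
    (hr : range s = U ∩ f ⁻¹' {z}) : fiberSum f U h z = ∑ j, h (s j) := by
  rw [fiberSum, ← hr, finsum_mem_range hs, finsum_eq_sum_of_fintype]

theorem HasDegree.exists_fiberSum_eq_sum (hm : HasDegree f U G m) (hU : IsOpen U)
    (hf : IsProperHolomorphic f U G) (hz : z ∈ G) (hreg : IsRegularValue f U z) :
    ∃ s : Fin m → (Fin n → ℂ), (∀ j, s j ∈ U ∩ f ⁻¹' {z}) ∧
      ∀ h, fiberSum f U h z = ∑ j, h (s j) := by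
  obtain ⟨k, s, hs, hr⟩ := (hf.finite_fiber hU hz hreg).fin_param
  obtain rfl : k = m := by
    rw [← hm z hz hreg, ← hr, ncard_range_of_injective hs, Nat.card_fin]
  exact ⟨s, fun j => hr ▸ mem_range_self j, fun h => fiberSum_eq_sum hs hr⟩

namespace IsProperHolomorphic

variable (hf : IsProperHolomorphic f U G) (hU : IsOpen U) (hG : IsOpen G)

include hf hG

theorem exists_hasDegree (hU : IsOpen U) (hGc : IsPreconnected G) : ∃ m, HasDegree f U G m := by
  by_cases hex : ∃ x ∈ G, IsRegularValue f U x
  · obtain ⟨x, hx, hxr⟩ := hex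
    exact ⟨_, fun y hy hyr => hf.ncard_fiber_eq hU hG hGc hy hyr hx hxr⟩
  · push Not at hex
    exact ⟨0, fun y hy hyr => absurd hyr (hex y hy)⟩

theorem exists_tendsto_of_eventually_mem_fiber (hz : z ∈ G) {u : Ultrafilter (Fin n → ℂ)}
    (hu : (u : Filter (Fin n → ℂ)) ≤ 𝓝 z) (ht : ∀ᶠ y in u, ∀ j, t y j ∈ U ∩ f ⁻¹' {y}) :
    ∃ s, Tendsto t u (𝓝 s) ∧ ∀ j, s j ∈ U ∩ f ⁻¹' {z} := by
  obtain ⟨R, hR, hRG⟩ := Metric.nhds_basis_closedBall.mem_iff.1 (hG.mem_nhds hz)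
  have hK : IsCompact (U ∩ f ⁻¹' closedBall z R) := hf.2.2 _ hRG (isCompact_closedBall _ _)
  have htK : ∀ᶠ y in u, t y ∈ univ.pi fun _ => U ∩ f ⁻¹' closedBall z R := by
    filter_upwards [ht, hu (closedBall_mem_nhds z hR)] with y hy hyR j _
    exact ⟨(hy j).1, by rwa [mem_preimage, show f (t y j) = y from (hy j).2]⟩
  obtain ⟨s, hsK, hs⟩ := (isCompact_univ_pi fun _ => hK).ultrafilter_le_nhds (u.map t)
    (le_principal_iff.2 htK)
  refine ⟨s, hs, fun j => ⟨(hsK j (mem_univ j)).1, ?_⟩⟩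
  have htj : Tendsto (fun y => t y j) u (𝓝[U] s j) := tendsto_nhdsWithin_iff.2
    ⟨((continuous_apply j).tendsto s).comp hs, ht.mono fun y hy => (hy j).1⟩
  exact tendsto_nhds_unique ((hf.1.continuousOn (s j) (hsK j (mem_univ j)).1).tendsto.comp htj)
    (Tendsto.congr' (ht.mono fun y hy => (hy j).2.symm) hu)

include hU

/- Over an arbitrary point the tuple is a limit of enumerations of fibres over regular values. -/
theorem exists_isFiberTuple (hm : HasDegree f U G m) :
    ∃ t : (Fin n → ℂ) → Fin m → (Fin n → ℂ), IsFiberTuple f U G t := by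
  suffices hex : ∀ z ∈ G, ∃ s : Fin m → (Fin n → ℂ), (∀ j, s j ∈ U ∩ f ⁻¹' {z}) ∧
      ∀ p, DifferentiableOn ℂ p U → ∑ j, p (s j) = fiberTrace f U p z by
    choose! t ht ht' using hex
    exact ⟨t, ht, ht'⟩
  have hreg : ∀ y ∈ {y ∈ G | IsRegularValue f U y}, ∃ s : Fin m → (Fin n → ℂ),
      (∀ j, s j ∈ U ∩ f ⁻¹' {y}) ∧ ∀ h, fiberSum f U h y = ∑ j, h (s j) :=
    fun y hy => hm.exists_fiberSum_eq_sum hU hf hy.1 hy.2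
  choose! t ht htsum using hreg
  intro z hz
  have hne : (𝓝[{y | IsRegularValue f U y}] z).NeBot :=
    mem_closure_iff_nhdsWithin_neBot.1 (dense_setOf_isRegularValue hU hf.1 z)
  let u := Ultrafilter.of (𝓝[{y | IsRegularValue f U y}] z)
  have hu : (u : Filter (Fin n → ℂ)) ≤ 𝓝[{y | IsRegularValue f U y}] z := Ultrafilter.of_le _
  have hu' := hu.trans nhdsWithin_le_nhds
  have huG : ∀ᶠ y in u, y ∈ {y ∈ G | IsRegularValue f U y} :=
    Filter.Eventually.and (hu' (hG.mem_nhds hz)) (hu eventually_mem_nhdsWithin)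
  obtain ⟨s, hts, hs⟩ := hf.exists_tendsto_of_eventually_mem_fiber hG hz hu' (huG.mono ht)
  refine ⟨s, hs, fun p hp => ?_⟩
  have hsum : Tendsto (fun y => ∑ j, p (t y j)) u (𝓝 (∑ j, p (s j))) :=
    tendsto_finsetSum _ fun j _ => (hp.continuousOn.continuousAt
      (hU.mem_nhds (hs j).1)).tendsto.comp (((continuous_apply j).tendsto s).comp hts)
  have htrace : Tendsto (fiberTrace f U p) u (𝓝 (fiberTrace f U p z)) :=
    ((hf.differentiableOn_fiberTrace hU hG hp).continuousOn.continuousAt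
      (hG.mem_nhds hz)).tendsto.mono_left hu'
  refine tendsto_nhds_unique hsum (htrace.congr' (huG.mono fun y hy => ?_))
  rw [hf.fiberTrace_eq_fiberSum hU hG hp.continuousOn hy.1 hy.2, htsum y hy]

theorem fiberTrace_inter_preimage (hL : IsOpen L) (hLG : L ⊆ G) (hh : DifferentiableOn ℂ h U)
    (hz : z ∈ L) : fiberTrace f (U ∩ f ⁻¹' L) h z = fiberTrace f U h z := by
  have hΛ : IsOpen (U ∩ f ⁻¹' L) := hf.1.continuousOn.isOpen_inter_preimage hU hL
  have hfL := hf.restrict_preimage hLG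
  have hhΛ : DifferentiableOn ℂ h (U ∩ f ⁻¹' L) := hh.mono inter_subset_left
  have hreg : ∀ y ∈ L ∩ {y | IsRegularValue f U y},
      fiberTrace f (U ∩ f ⁻¹' L) h y = fiberTrace f U h y := fun y hy => by
    rw [hfL.fiberTrace_eq_fiberSum hΛ hL hhΛ.continuousOn hy.1
      ((isRegularValue_inter_preimage hy.1).2 hy.2),
      hf.fiberTrace_eq_fiberSum hU hG hh.continuousOn (hLG hy.1) hy.2, fiberSum, fiberSum,
      inter_preimage_inter_preimage_of_subset (singleton_subset_iff.2 hy.1)]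
  exact EqOn.of_subset_closure hreg
    (hfL.differentiableOn_fiberTrace hΛ hL hhΛ).continuousOn
    ((hf.differentiableOn_fiberTrace hU hG hh).continuousOn.mono hLG) inter_subset_left
    ((dense_setOf_isRegularValue hU hf.1).open_subset_closure_inter hL) hz

end IsProperHolomorphic

namespace IsFiberTuple

variable (ht : IsFiberTuple f U G t) (hf : IsProperHolomorphic f U G) (hU : IsOpen U)
  (hG : IsOpen G)

include ht hf hU hG

theorem exists_tendsto_forall_sum_eq (hz : z ∈ G) {u : Ultrafilter (Fin n → ℂ)}
    (hu : (u : Filter (Fin n → ℂ)) ≤ 𝓝 z) :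
    ∃ s, Tendsto t u (𝓝 s) ∧ ∀ h : (Fin n → ℂ) → ℂ, ∑ j, h (s j) = ∑ j, h (t z j) := by
  have huG : ∀ᶠ y in u, y ∈ G := hu (hG.mem_nhds hz)
  obtain ⟨s, hts, -⟩ := hf.exists_tendsto_of_eventually_mem_fiber hG hz hu
    (huG.mono fun y hy => ht.mem y hy)
  refine ⟨s, hts, sum_eq_of_forall_differentiable fun p hp => ?_⟩
  have hsum : Tendsto (fun y => ∑ j, p (t y j)) u (𝓝 (∑ j, p (s j))) :=
    tendsto_finsetSum _ fun j _ => (hp.continuous.tendsto _).comp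
      (((continuous_apply j).tendsto s).comp hts)
  have htrace : Tendsto (fiberTrace f U p) u (𝓝 (fiberTrace f U p z)) :=
    ((hf.differentiableOn_fiberTrace hU hG hp.differentiableOn).continuousOn.continuousAt
      (hG.mem_nhds hz)).tendsto.mono_left hu
  rw [ht.sum_eq z hz p hp.differentiableOn]
  exact tendsto_nhds_unique hsum
    (htrace.congr' (huG.mono fun y hy => (ht.sum_eq y hy p hp.differentiableOn).symm))

theorem mem_closure (hLG : closure L ⊆ G) (hz : z ∈ closure L) (j : Fin m) :
    t z j ∈ closure (U ∩ f ⁻¹' L) := by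
  obtain ⟨u, huL, hu⟩ := mem_closure_iff_ultrafilter.1 hz
  obtain ⟨s, hs, hsum⟩ := ht.exists_tendsto_forall_sum_eq hf hU hG (hLG hz) hu
  obtain ⟨i, hi⟩ := exists_eq_of_forall_sum_eq hsum j
  rw [← hi]
  refine mem_closure_of_tendsto (((continuous_apply i).tendsto s).comp hs) ?_
  filter_upwards [huL] with y hy
  have hmem := ht.mem y (hLG (subset_closure hy)) i
  exact ⟨hmem.1, by rwa [mem_preimage, Function.comp_apply, show f (t y i) = y from hmem.2]⟩

theorem continuousOn_sum (hLG : closure L ⊆ G) (hh : ContinuousOn h (closure (U ∩ f ⁻¹' L))) :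
    ContinuousOn (fun z => ∑ j, h (t z j)) (closure L) := by
  intro z hz
  refine (tendsto_iff_ultrafilter _ _ _).2 fun u hu => ?_
  obtain ⟨s, hs, hsum⟩ :=
    ht.exists_tendsto_forall_sum_eq hf hU hG (hLG hz) (hu.trans nhdsWithin_le_nhds)
  beta_reduce
  rw [← hsum h]
  have hmem : ∀ j, ∀ᶠ y in u, t y j ∈ closure (U ∩ f ⁻¹' L) := fun j =>
    hu (eventually_mem_nhdsWithin.mono fun y hy => ht.mem_closure hf hU hG hLG hy j)
  refine tendsto_finsetSum _ fun j _ => ?_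
  have hsj : Tendsto (fun y => t y j) u (𝓝 (s j)) := ((continuous_apply j).tendsto s).comp hs
  exact (hh (s j) (isClosed_closure.mem_of_tendsto hsj (hmem j))).tendsto.comp
    (tendsto_nhdsWithin_iff.2 ⟨hsj, hmem j⟩)

theorem sum_eq_fiberTrace (hm : HasDegree f U G m) (hL : IsOpen L) (hLG : L ⊆ G)
    (hh : DifferentiableOn ℂ h (U ∩ f ⁻¹' L)) (hz : z ∈ L) :
    ∑ j, h (t z j) = fiberTrace f (U ∩ f ⁻¹' L) h z := by
  obtain ⟨s, hs⟩ := (hf.restrict_preimage hLG).exists_isFiberTuple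
    (hf.1.continuousOn.isOpen_inter_preimage hU hL) hL (hm.restrict_preimage hLG)
  rw [← hs.sum_eq z hz h hh]
  refine sum_eq_of_forall_differentiable (fun p hp => ?_) h
  rw [ht.sum_eq z (hLG hz) p hp.differentiableOn, hs.sum_eq z hz p hp.differentiableOn,
    hf.fiberTrace_inter_preimage hU hG hL hLG hp.differentiableOn hz]

theorem diffContOnCl_sum (hm : HasDegree f U G m) (hL : IsOpen L) (hLG : closure L ⊆ G)
    (hh : DiffContOnCl ℂ h (U ∩ f ⁻¹' L)) : DiffContOnCl ℂ (fun z => ∑ j, h (t z j)) L where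
  differentiableOn :=
    ((hf.restrict_preimage (subset_closure.trans hLG)).differentiableOn_fiberTrace
      (hf.1.continuousOn.isOpen_inter_preimage hU hL) hL hh.differentiableOn).congr fun _ hz =>
        ht.sum_eq_fiberTrace hf hU hG hm hL (subset_closure.trans hLG) hh.differentiableOn hz
  continuousOn := ht.continuousOn_sum hf hU hG hLG hh.continuousOn

end IsFiberTuple

end FiberTuples

section Shilov

open Filter Topology Metric Set

section General

variable {V : Type*} [NormedAddCommGroup V] [NormedSpace ℂ V] {D E F S : Set V}

theorem isClosedBoundary_closure : IsClosedBoundary D (closure D) :=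
  ⟨isClosed_closure, Subset.rfl, fun _ _ x hx => ⟨x, hx, le_rfl⟩⟩

theorem shilovBoundary_subset (hS : IsClosedBoundary D S) : shilovBoundary D ⊆ S :=
  sInter_subset_of_mem hS

theorem isClosedBoundary_of_forall_norm_le (hD : IsCompact (closure D)) (hS : IsClosed S)
    (hSD : S ⊆ closure D)
    (h : ∀ g : V → ℂ, DiffContOnCl ℂ g D → ∀ c ≥ 0, (∀ y ∈ S, ‖g y‖ ≤ c) → ∀ x ∈ D, ‖g x‖ ≤ c) :
    IsClosedBoundary D S := by
  refine ⟨hS, hSD, fun g hg x hx => ?_⟩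
  have hne : S.Nonempty := by
    by_contra! hS0
    obtain ⟨w, hw⟩ := closure_nonempty_iff.1 ⟨x, hx⟩
    simpa using (h (fun _ => 1) diffContOnCl_const 0 le_rfl (by simp [hS0]) w hw).trans_lt one_pos
  obtain ⟨y, hy, hmax⟩ := (hD.of_isClosed_subset hS hSD).exists_isMaxOn hne
    (hg.continuousOn.norm.mono hSD)
  have hle := h g hg ‖g y‖ (norm_nonneg _) fun z hz => hmax hz
  exact ⟨y, hy, le_on_closure hle hg.continuousOn.norm continuousOn_const hx⟩

theorem isShilovBoundary_of_peak (h : IsClosedBoundary D S)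
    (hpeak : ∀ u ∈ S, ∃ g : V → ℂ, DiffContOnCl ℂ g D ∧
      ∀ y ∈ closure D, ‖g u‖ ≤ ‖g y‖ → y = u) : IsShilovBoundary D S := by
  refine ⟨h, fun T hT u hu => ?_⟩
  obtain ⟨g, hg, hgu⟩ := hpeak u hu
  obtain ⟨y, hy, hle⟩ := hT.2.2 g hg u (h.2.1 hu)
  rwa [← hgu y (hT.2.1 hy) hle]

/- If `‖g‖` had maximum `M` on `closure D` but were at most `c < M` on the smaller set, then some
`g ^ k * φ i` would be smaller than `M ^ k` on `E`, but not at a point of `F` where `‖g‖ = M`. -/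
theorem IsClosedBoundary.sdiff (hD : IsCompact (closure D)) (hE : IsClosedBoundary D E)
    (hF : IsClosedBoundary D F) {ι : Type*} {φ : ι → V → ℂ} (hφ : ∀ i, DiffContOnCl ℂ (φ i) D)
    (hN : IsOpen {y | ∀ i, ‖φ i y‖ < 1}) (hFN : Disjoint F {y | ∀ i, ‖φ i y‖ < 1}) :
    IsClosedBoundary D (E \ {y | ∀ i, ‖φ i y‖ < 1}) := by
  refine isClosedBoundary_of_forall_norm_le hD (hE.1.sdiff hN) (sdiff_subset.trans hE.2.1)
    fun g hg c hc hgc x hx => ?_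
  by_contra! hcx
  obtain ⟨x₁, hx₁, hmax⟩ := hD.exists_isMaxOn ⟨x, subset_closure hx⟩ hg.continuousOn.norm
  have hcM : c < ‖g x₁‖ := hcx.trans_le (hmax (subset_closure hx))
  have hM : 0 < ‖g x₁‖ := hc.trans_lt hcM
  obtain ⟨y, hyF, hy⟩ := hF.2.2 g hg x₁ hx₁
  obtain ⟨i, hi⟩ : ∃ i, 1 ≤ ‖φ i y‖ := by
    have hyN := Set.disjoint_left.1 hFN hyF
    rw [mem_ofPred_eq] at hyN
    push Not at hyN
    exact hyN
  obtain ⟨C, hC⟩ := hD.exists_bound_of_continuousOn (hφ i).continuousOn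
  obtain ⟨k, hk⟩ : ∃ k : ℕ, c ^ k * C < ‖g x₁‖ ^ k := by
    have hlim : Tendsto (fun k : ℕ => (c / ‖g x₁‖) ^ k * C) atTop (𝓝 (0 * C)) :=
      (tendsto_pow_atTop_nhds_zero_of_lt_one (by positivity) ((div_lt_one hM).2 hcM)).mul_const C
    rw [zero_mul] at hlim
    obtain ⟨k, hk⟩ := (hlim.eventually_lt_const one_pos).exists
    rw [div_pow, div_mul_eq_mul_div, div_lt_one (by positivity)] at hk
    exact ⟨k, hk⟩
  obtain ⟨w, hwE, hyw⟩ := hE.2.2 (fun w => g w ^ k * φ i w)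
    ⟨(hg.1.pow k).mul (hφ i).1, (hg.2.pow k).mul (hφ i).2⟩ y (hF.2.1 hyF)
  have hwD := hE.2.1 hwE
  refine absurd hyw (not_le.2 ?_)
  rw [norm_mul, norm_mul, norm_pow, norm_pow]
  calc ‖g w‖ ^ k * ‖φ i w‖ < ‖g x₁‖ ^ k := by
        by_cases hwN : ∀ i, ‖φ i w‖ < 1
        · exact (mul_le_mul_of_nonneg_right (pow_le_pow_left₀ (norm_nonneg _) (hmax hwD) k)
            (norm_nonneg _)).trans_lt (mul_lt_of_lt_one_right (by positivity) (hwN i))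
        · refine lt_of_le_of_lt ?_ hk
          gcongr
          exacts [hgc w ⟨hwE, hwN⟩, hC w hwD]
    _ ≤ ‖g y‖ ^ k * ‖φ i y‖ :=
        (pow_le_pow_left₀ hM.le hy k).trans (le_mul_of_one_le_right (by positivity) hi)

theorem IsClosedBoundary.exists_mem_nhds_sdiff [FiniteDimensional ℂ V]
    (hD : IsCompact (closure D)) (hF : IsClosedBoundary D F) {p : V} (hp : p ∉ F) :
    ∃ N ∈ 𝓝 p, IsOpen N ∧ ∀ E, IsClosedBoundary D E → IsClosedBoundary D (E \ N) := by
  let e : V ≃L[ℂ] (Fin (Module.finrank ℂ V) → ℂ) := (Module.finBasis ℂ V).equivFunL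
  obtain ⟨r, hr, hrF⟩ := Metric.mem_nhds_iff.1
    (e.symm.continuous.continuousAt.preimage_mem_nhds (x := e p)
      (by rw [e.symm_apply_apply]; exact hF.1.isOpen_compl.mem_nhds hp))
  have hball : e ⁻¹' ball (e p) r = {y | ∀ i, ‖(e y i - e p i) / r‖ < 1} := by
    ext y
    simp only [mem_preimage, mem_ball, dist_pi_lt_iff hr, mem_ofPred_eq, norm_div,
      Complex.norm_real, Real.norm_of_nonneg hr.le, div_lt_one hr, Complex.dist_eq]
  have hopen : IsOpen (e ⁻¹' ball (e p) r) := isOpen_ball.preimage e.continuous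
  have hdisj : Disjoint F (e ⁻¹' ball (e p) r) := Set.disjoint_left.2 fun y hyF hy => by
    simpa [hyF] using hrF hy
  refine ⟨e ⁻¹' ball (e p) r, hopen.mem_nhds (mem_ball_self hr), hopen, fun E hE => ?_⟩
  rw [hball] at hopen hdisj ⊢
  have hφ (i) : Differentiable ℂ fun y => (e y i - e p i) / (r : ℂ) := by
    simp only [div_eq_mul_inv]
    exact ((differentiable_pi.1 e.differentiable i).sub_const _).mul_const _
  exact hE.sdiff hD hF (fun i => (hφ i).diffContOnCl) hopen hdisj

theorem isShilovBoundary_shilovBoundary [FiniteDimensional ℂ V] (hD : IsCompact (closure D)) :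
    IsShilovBoundary D (shilovBoundary D) := by
  refine ⟨⟨isClosed_sInter fun S hS => hS.1, shilovBoundary_subset isClosedBoundary_closure,
    fun g hg x hx => ?_⟩, fun S hS => shilovBoundary_subset hS⟩
  by_contra! hlt
  have hK : IsCompact (closure D ∩ (fun y => ‖g y‖) ⁻¹' Ici ‖g x‖) := hD.of_isClosed_subset
    (hg.continuousOn.norm.preimage_isClosed_of_isClosed isClosed_closure isClosed_Ici)
    inter_subset_left
  obtain ⟨N, hKN, -, hN⟩ : ∃ N, closure D ∩ (fun y => ‖g y‖) ⁻¹' Ici ‖g x‖ ⊆ N ∧ IsOpen N ∧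
      ∀ E, IsClosedBoundary D E → IsClosedBoundary D (E \ N) := by
    refine hK.induction_on ⟨∅, Subset.rfl, isOpen_empty, fun E hE => by rwa [sdiff_empty]⟩
      (fun s t hst ⟨N, hN⟩ => ⟨N, hst.trans hN.1, hN.2⟩) ?_ fun p hp => ?_
    · rintro s t ⟨N, hsN, hNo, hN⟩ ⟨N', htN', hNo', hN'⟩
      refine ⟨N ∪ N', union_subset_union hsN htN', hNo.union hNo', fun E hE => ?_⟩
      rw [← sdiff_sdiff]
      exact hN' _ (hN E hE)
    · obtain ⟨F, hF, hpF⟩ : ∃ F, IsClosedBoundary D F ∧ p ∉ F := by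
        have hpS : p ∉ shilovBoundary D := fun h => not_lt.2 hp.2 (hlt p h)
        simpa only [shilovBoundary, mem_sInter, not_forall, exists_prop, mem_ofPred_eq] using hpS
      obtain ⟨N, hpN, hN⟩ := hF.exists_mem_nhds_sdiff hD hpF
      exact ⟨N, mem_nhdsWithin_of_mem_nhds hpN, N, Subset.rfl, hN⟩
  obtain ⟨y, hy, hle⟩ := (hN _ isClosedBoundary_closure).2.2 g hg x hx
  exact hy.2 (hKN ⟨hy.1, hle⟩)

end General

section Proper

variable {n : ℕ} {D G L S : Set (Fin n → ℂ)} {f : (Fin n → ℂ) → (Fin n → ℂ)}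

theorem le_of_forall_pow_le_mul_pow {a c A : ℝ} (hc : 0 ≤ c) (h : ∀ k : ℕ, a ^ k ≤ A * c ^ k) :
    a ≤ c := by
  by_contra! hca
  obtain rfl | hc' := hc.eq_or_lt
  · exact absurd (h 1) (by simpa using hca)
  · obtain ⟨k, hk⟩ := pow_unbounded_of_one_lt A ((one_lt_div hc').2 hca)
    rw [div_pow, lt_div_iff₀ (by positivity)] at hk
    exact absurd (h k) (not_le.2 hk)

theorem closure_inter_preimage_subset {V W : Type*} [NormedAddCommGroup V] [NormedSpace ℂ V]
    [NormedAddCommGroup W] [NormedSpace ℂ W] {f : V → W} {D : Set V} {G L : Set W}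
    (hf : IsProperHolomorphic f D G) (hL : RelCompactIn L G) :
    closure (D ∩ f ⁻¹' L) ⊆ D ∩ f ⁻¹' closure L :=
  closure_minimal (inter_subset_inter_right D (preimage_mono subset_closure))
    (hf.2.2 _ hL.2 hL.1).isClosed

theorem isCompact_closure_inter_preimage {V W : Type*} [NormedAddCommGroup V] [NormedSpace ℂ V]
    [NormedAddCommGroup W] [NormedSpace ℂ W] {f : V → W} {D : Set V} {G L : Set W}
    (hf : IsProperHolomorphic f D G) (hL : RelCompactIn L G) :
    IsCompact (closure (D ∩ f ⁻¹' L)) :=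
  (hf.2.2 _ hL.2 hL.1).of_isClosed_subset isClosed_closure (closure_inter_preimage_subset hf hL)

theorem IsClosedBoundary.image (hD : IsOpen D) (hDne : D.Nonempty) (hG : IsDomainSet G)
    (hf : IsProperHolomorphic f D G) (hL : RelCompactIn L G)
    (hS : IsClosedBoundary (D ∩ f ⁻¹' L) S) : IsClosedBoundary L (f '' S) := by
  have hcl := closure_inter_preimage_subset hf hL
  have hc := isCompact_closure_inter_preimage hf hL
  have hfc : ContinuousOn f (closure (D ∩ f ⁻¹' L)) :=
    hf.1.continuousOn.mono (hcl.trans inter_subset_left)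
  refine ⟨((hc.of_isClosed_subset hS.1 hS.2.1).image_of_continuousOn
    (hfc.mono hS.2.1)).isClosed, image_subset_iff.2 fun w hw => (hcl (hS.2.1 hw)).2,
    fun g hg x hx => ?_⟩
  have hLim : closure L ⊆ f '' closure (D ∩ f ⁻¹' L) := by
    refine closure_minimal (fun z hz => ?_) (hc.image_of_continuousOn hfc).isClosed
    obtain ⟨w, hw, rfl⟩ := hf.subset_image hD hG.1 hG.2.isPreconnected hDne
      (hL.2 (subset_closure hz))
    exact ⟨w, subset_closure ⟨hw, hz⟩, rfl⟩
  obtain ⟨w, hw, rfl⟩ := hLim hx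
  have hgf : DiffContOnCl ℂ (g ∘ f) (D ∩ f ⁻¹' L) :=
    ⟨hg.1.comp (hf.1.mono inter_subset_left) fun w hw => hw.2,
      hg.2.comp hfc fun w hw => (hcl hw).2⟩
  obtain ⟨y, hy, hle⟩ := hS.2.2 (g ∘ f) hgf w hw
  exact ⟨f y, mem_image_of_mem f hy, hle⟩

theorem exists_differentiable_fiberSum_mul_eq {w : Fin n → ℂ} (hw : w ∈ D)
    (hfin : (D ∩ f ⁻¹' {f w}).Finite) :
    ∃ p : (Fin n → ℂ) → ℂ, Differentiable ℂ p ∧ ∀ h : (Fin n → ℂ) → ℂ,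
      fiberSum f D (fun x => p x * h x) (f w) = h w := by
  obtain ⟨p, hp, hpw, hp0⟩ :=
    exists_differentiable_eq_one_eqOn_zero (hfin.toFinset.notMem_erase w)
  refine ⟨p, hp, fun h => ?_⟩
  rw [fiberSum, finsum_mem_eq_finite_toFinset_sum _ hfin,
    Finset.sum_eq_single_of_mem w (hfin.mem_toFinset.2 ⟨hw, rfl⟩) fun b hb hbw => ?_, hpw, one_mul]
  rw [hp0 (Finset.mem_coe.2 (Finset.mem_erase.2 ⟨hbw, hb⟩)), Pi.zero_apply, zero_mul]

/- If `p` vanishes on the fibre through `w` except that `p w = 1`, the trace of `p * h ^ k` takes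
the value `h w ^ k` at `f w`. Its bound by a multiple of the `k`-th power of the supremum of `‖h‖`
over the preimage of `S` gives the claim as `k` tends to infinity. -/
theorem IsClosedBoundary.norm_le_of_isRegularValue (hD : IsOpen D) (hG : IsDomainSet G)
    (hf : IsProperHolomorphic f D G) (hLo : IsOpen L) (hL : RelCompactIn L G)
    (hS : IsClosedBoundary L S) {h : (Fin n → ℂ) → ℂ} (hh : DiffContOnCl ℂ h (D ∩ f ⁻¹' L))
    {c : ℝ} (hc : 0 ≤ c) (hhc : ∀ y ∈ closure (D ∩ f ⁻¹' L) ∩ f ⁻¹' S, ‖h y‖ ≤ c)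
    {w : Fin n → ℂ} (hw : w ∈ D ∩ f ⁻¹' L) (hreg : IsRegularValue f D (f w)) : ‖h w‖ ≤ c := by
  have hfw : f w ∈ L := hw.2
  have hLG : L ⊆ G := subset_closure.trans hL.2
  have hΛ : IsOpen (D ∩ f ⁻¹' L) := hf.1.continuousOn.isOpen_inter_preimage hD hLo
  have hfΛ := hf.restrict_preimage hLG
  have hregΛ : IsRegularValue f (D ∩ f ⁻¹' L) (f w) := (isRegularValue_inter_preimage hfw).2 hreg
  obtain ⟨m, hm⟩ := hf.exists_hasDegree hG.1 hD hG.2.isPreconnected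
  obtain ⟨t, ht⟩ := hf.exists_isFiberTuple hD hG.1 hm
  obtain ⟨p, hp, hpw⟩ :=
    exists_differentiable_fiberSum_mul_eq hw (hfΛ.finite_fiber hΛ hfw hregΛ)
  obtain ⟨B, hB⟩ := (isCompact_closure_inter_preimage hf hL).exists_bound_of_continuousOn
    hp.continuous.continuousOn
  refine le_of_forall_pow_le_mul_pow (A := m * B) hc fun k => ?_
  have hphk : DiffContOnCl ℂ (fun x => p x * h x ^ k) (D ∩ f ⁻¹' L) :=
    ⟨hp.differentiableOn.mul (hh.1.pow k), hp.continuous.continuousOn.mul (hh.2.pow k)⟩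
  have htrace : ∑ j, p (t (f w) j) * h (t (f w) j) ^ k = h w ^ k := by
    rw [ht.sum_eq_fiberTrace hf hD hG.1 hm hLo hLG hphk.1 hfw,
      hfΛ.fiberTrace_eq_fiberSum hΛ hLo hphk.1.continuousOn hfw hregΛ, hpw]
  obtain ⟨y, hyS, hle⟩ := hS.2.2 _ (ht.diffContOnCl_sum hf hD hG.1 hm hLo hL.2 hphk) (f w)
    (subset_closure hfw)
  have hyL := hS.2.1 hyS
  calc ‖h w‖ ^ k = ‖∑ j, p (t (f w) j) * h (t (f w) j) ^ k‖ := by rw [htrace, norm_pow]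
    _ ≤ ∑ j, ‖p (t y j) * h (t y j) ^ k‖ := hle.trans (norm_sum_le _ _)
    _ ≤ ∑ _j : Fin m, B * c ^ k := Finset.sum_le_sum fun j _ => by
        have hmem := ht.mem_closure hf hD hG.1 hL.2 hyL j
        rw [norm_mul, norm_pow]
        gcongr
        · exact (norm_nonneg _).trans (hB _ hmem)
        · exact hB _ hmem
        · exact hhc _ ⟨hmem, by rwa [mem_preimage, show f (t y j) = y from
            (ht.mem y (hL.2 hyL) j).2]⟩
    _ = m * B * c ^ k := by simp [mul_assoc]

theorem IsClosedBoundary.preimage (hD : IsOpen D) (hG : IsDomainSet G)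
    (hf : IsProperHolomorphic f D G) (hLo : IsOpen L) (hL : RelCompactIn L G)
    (hS : IsClosedBoundary L S) :
    IsClosedBoundary (D ∩ f ⁻¹' L) (closure (D ∩ f ⁻¹' L) ∩ f ⁻¹' S) := by
  have hfc : ContinuousOn f (closure (D ∩ f ⁻¹' L)) := hf.1.continuousOn.mono
    ((closure_inter_preimage_subset hf hL).trans inter_subset_left)
  refine isClosedBoundary_of_forall_norm_le (isCompact_closure_inter_preimage hf hL)
    (hfc.preimage_isClosed_of_isClosed isClosed_closure hS.1) inter_subset_left
    fun h hh c hc hhc x hx => ?_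
  by_contra! hcx
  have hopen : IsOpen (D ∩ f ⁻¹' L ∩ (fun w => ‖h w‖) ⁻¹' Ioi c) :=
    hh.1.continuousOn.norm.isOpen_inter_preimage
      (hf.1.continuousOn.isOpen_inter_preimage hD hLo) isOpen_Ioi
  obtain ⟨w, ⟨hw, hcw⟩, hreg⟩ := hf.exists_mem_isRegularValue hD hG.1 hopen
    (inter_subset_left.trans inter_subset_left) ⟨x, hx, hcx⟩
  exact not_lt.2 (hS.norm_le_of_isRegularValue hD hG hf hLo hL hh hc hhc hw hreg) hcw

theorem shilovBoundary_eq_image (hD : IsOpen D) (hDne : D.Nonempty) (hG : IsDomainSet G)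
    (hf : IsProperHolomorphic f D G) (hLo : IsOpen L) (hL : RelCompactIn L G) :
    shilovBoundary L = f '' shilovBoundary (D ∩ f ⁻¹' L) := by
  have hbdL := isShilovBoundary_shilovBoundary hL.1
  have hbd := isShilovBoundary_shilovBoundary (isCompact_closure_inter_preimage hf hL)
  refine Subset.antisymm (shilovBoundary_subset (hbd.1.image hD hDne hG hf hL))
    (image_subset_iff.2 fun w hw => ?_)
  exact (shilovBoundary_subset (hbdL.1.preimage hD hG hf hLo hL) hw).2

end Proper

end Shilov

section UnitBalls

open Filter Topology Metric Set

section ComplexExtremePoints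

/-- The complex extreme points of `K`: the points of `K` that are not the centre of a nondegenerate
complex disc contained in `K`. -/
def complexExtremePoints {V : Type*} [AddCommGroup V] [Module ℂ V] (K : Set V) : Set V :=
  {z ∈ K | ∀ v : V, (∀ ζ : ℂ, ‖ζ‖ ≤ 1 → z + ζ • v ∈ K) → v = 0}

theorem exists_continuous_two_mul_lt_add {E : Type*} [NormedAddCommGroup E] [NormedSpace ℝ E]
    [FiniteDimensional ℝ E] :
    ∃ q : E → ℝ, Continuous q ∧ ∀ z v, v ≠ 0 → 2 * q z < q (z + v) + q (z - v) := by
  refine ⟨fun z => ‖toEuclidean z‖ ^ 2, by fun_prop, fun z v hv => ?_⟩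
  have hpar := parallelogram_law_with_norm ℝ (toEuclidean z) (toEuclidean v)
  have hpos : 0 < ‖toEuclidean v‖ := norm_pos_iff.2 (by simpa using hv)
  simp only [map_add, map_sub]
  nlinarith

variable {V : Type*} [NormedAddCommGroup V] [NormedSpace ℂ V] {K S U : Set V} {g : V → ℂ}

theorem norm_add_smul_eq_of_isMaxOn (hKU : K ⊆ U) (hg : DifferentiableOn ℂ g U) {z v : V}
    (hmax : IsMaxOn (norm ∘ g) K z) (hv : ∀ ζ : ℂ, ‖ζ‖ ≤ 1 → z + ζ • v ∈ K) {ζ : ℂ}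
    (hζ : ‖ζ‖ ≤ 1) : ‖g (z + ζ • v)‖ = ‖g z‖ := by
  have hmaps : MapsTo (fun ζ : ℂ => z + ζ • v) (closedBall 0 1) K := fun ζ hζ =>
    hv ζ (mem_closedBall_zero_iff.1 hζ)
  have hdiff : DiffContOnCl ℂ (fun ζ : ℂ => g (z + ζ • v)) (ball 0 1) := by
    refine DifferentiableOn.diffContOnCl (hg.comp (by fun_prop) ?_)
    exact (hmaps.mono closure_ball_subset_closedBall hKU)
  have hmax' : IsMaxOn (norm ∘ fun ζ : ℂ => g (z + ζ • v)) (ball 0 1) 0 := fun ξ hξ => by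
    simpa using hmax (hmaps (ball_subset_closedBall hξ))
  simpa using Complex.norm_eqOn_closedBall_of_isMaxOn hdiff hmax' (mem_closedBall_zero_iff.2 hζ)

/- Among the points where `‖g‖` is maximal, take one where a strictly midpoint-convex function is
maximal: a complex disc around it would contradict the maximum principle. -/
theorem exists_mem_complexExtremePoints_norm_le [FiniteDimensional ℂ V] (hK : IsCompact K)
    (hKU : K ⊆ U) (hg : DifferentiableOn ℂ g U) {x : V} (hx : x ∈ K) :
    ∃ y ∈ complexExtremePoints K, ‖g x‖ ≤ ‖g y‖ := by
  have : FiniteDimensional ℝ V := FiniteDimensional.complexToReal V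
  obtain ⟨q, hq, hq_lt⟩ := exists_continuous_two_mul_lt_add (E := V)
  have hgc : ContinuousOn g K := hg.continuousOn.mono hKU
  obtain ⟨x₁, hx₁, hmax⟩ := hK.exists_isMaxOn ⟨x, hx⟩ hgc.norm
  have hpeak : IsCompact (K ∩ (fun y => ‖g y‖) ⁻¹' {‖g x₁‖}) := hK.of_isClosed_subset
    (hgc.norm.preimage_isClosed_of_isClosed hK.isClosed isClosed_singleton) inter_subset_left
  obtain ⟨z, ⟨hz, hzg⟩, hzmax⟩ := hpeak.exists_isMaxOn ⟨x₁, hx₁, rfl⟩ hq.continuousOn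
  replace hzg : ‖g z‖ = ‖g x₁‖ := hzg
  refine ⟨z, ⟨hz, fun v hv => ?_⟩, (hmax hx).trans hzg.ge⟩
  by_contra hv0
  have hle (ζ : ℂ) (hζ : ‖ζ‖ ≤ 1) : q (z + ζ • v) ≤ q z := by
    refine hzmax ⟨hv ζ hζ, ?_⟩
    have hzmaxg : IsMaxOn (norm ∘ g) K z := fun y hy => (hmax hy).trans hzg.ge
    exact (norm_add_smul_eq_of_isMaxOn hKU hg hzmaxg hv hζ).trans hzg
  have hpos := hle 1 (by simp)
  have hneg := hle (-1) (by simp)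
  rw [one_smul] at hpos
  rw [neg_one_smul, ← sub_eq_add_neg] at hneg
  linarith [hq_lt z v hv0]

theorem exists_forall_norm_smul_sub_lt [ProperSpace V] (hg : ContinuousOn g (closedBall 0 1))
    {ε : ℝ} (hε : 0 < ε) :
    ∃ r ∈ Ioo (0 : ℝ) 1, ∀ y ∈ closedBall (0 : V) 1, ‖g ((r : ℂ) • y) - g y‖ < ε := by
  have huc := (isCompact_closedBall (0 : V) 1).uniformContinuousOn_of_continuous hg
  obtain ⟨δ, hδ, hgδ⟩ := Metric.uniformContinuousOn_iff.1 huc ε hε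
  obtain ⟨r, hr, hr1⟩ := exists_between (max_lt (sub_lt_self 1 hδ) one_pos)
  have hr0 : 0 < r := (le_max_right _ _).trans_lt hr
  refine ⟨r, ⟨hr0, hr1⟩, fun y hy => ?_⟩
  have hy1 : ‖y‖ ≤ 1 := mem_closedBall_zero_iff.1 hy
  rw [← dist_eq_norm]
  refine hgδ _ (mem_closedBall_zero_iff.2 ?_) y hy ?_
  · rw [norm_smul, Complex.norm_real, Real.norm_of_nonneg hr0.le]
    exact mul_le_one₀ hr1.le (norm_nonneg _) hy1
  · have hsub : (r : ℂ) • y - y = ((r - 1 : ℝ) : ℂ) • y := by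
      push_cast
      rw [sub_smul, one_smul]
    rw [dist_eq_norm, hsub, norm_smul, Complex.norm_real, Real.norm_of_nonpos (by linarith)]
    nlinarith [le_max_left (1 - δ) 0, norm_nonneg y]

theorem isClosedBoundary_ball [FiniteDimensional ℂ V] (hS : IsClosed S)
    (hSb : S ⊆ closedBall 0 1) (hext : complexExtremePoints (closedBall 0 1) ⊆ S) :
    IsClosedBoundary (ball (0 : V) 1) S := by
  have : ProperSpace V := FiniteDimensional.proper ℂ V
  have hcl : closure (ball (0 : V) 1) = closedBall 0 1 := closure_ball 0 one_ne_zero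
  have hc := isCompact_closedBall (0 : V) 1
  refine isClosedBoundary_of_forall_norm_le (hcl ▸ hc) hS (hcl ▸ hSb)
    fun g hg c _ hgc x hx => le_of_forall_pos_le_add fun ε hε => ?_
  obtain ⟨r, hr, hgr⟩ := exists_forall_norm_smul_sub_lt (hcl ▸ hg.continuousOn) (half_pos hε)
  have hmaps : MapsTo (fun y : V => (r : ℂ) • y) (ball 0 (1 / r)) (ball 0 1) := fun y hy => by
    rw [mem_ball_zero_iff] at hy ⊢
    rwa [norm_smul, Complex.norm_real, Real.norm_of_nonneg hr.1.le, ← lt_div_iff₀' hr.1]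
  obtain ⟨y, hy, hle⟩ := exists_mem_complexExtremePoints_norm_le hc
    (closedBall_subset_ball ((one_lt_div hr.1).2 hr.2))
    (hg.differentiableOn.comp (by fun_prop) hmaps) (ball_subset_closedBall hx)
  have hxε := norm_sub_norm_le (g x) (g ((r : ℂ) • x))
  rw [norm_sub_rev] at hxε
  have hyε := norm_sub_norm_le (g ((r : ℂ) • y)) (g y)
  simp only [Function.comp_apply] at hle
  linarith [hgc y (hext hy), hgr x (ball_subset_closedBall hx), hgr y hy.1]

end ComplexExtremePoints

theorem eq_one_of_two_le_norm_one_add {a : ℂ} (ha : ‖a‖ ≤ 1) (h : 2 ≤ ‖1 + a‖) : a = 1 := by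
  have hsame : SameRay ℝ 1 a := sameRay_iff_norm_add.2
    (le_antisymm (norm_add_le _ _) (by rw [norm_one]; linarith))
  refine (hsame.eq_of_norm_eq ?_).symm
  have := norm_add_le 1 a
  rw [norm_one] at this ⊢
  linarith

theorem eq_one_of_le_norm_sum {ι : Type*} [Fintype ι] {a : ι → ℂ} (ha : ∀ i, ‖a i‖ ≤ 1)
    (h : 2 * (Fintype.card ι : ℝ) ≤ ‖∑ i, (1 + a i)‖) (i : ι) : a i = 1 := by
  refine eq_one_of_two_le_norm_one_add (ha i) ?_
  by_contra! hlt
  have hle (j) : ‖1 + a j‖ ≤ 2 := by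
    have := norm_add_le 1 (a j)
    rw [norm_one] at this
    linarith [ha j]
  have hsum : ∑ j, ‖1 + a j‖ < ∑ _j : ι, (2 : ℝ) :=
    Finset.sum_lt_sum (fun j _ => hle j) ⟨i, Finset.mem_univ i, hlt⟩
  rw [Finset.sum_const, Finset.card_univ, nsmul_eq_mul] at hsum
  linarith [norm_sum_le Finset.univ fun j => 1 + a j]

section Polydisc

variable {n : ℕ}

theorem polydisc_eq_ball : polydisc n = ball 0 1 := by
  ext z
  rw [mem_ball_zero_iff, pi_norm_lt_iff one_pos]
  rfl

theorem isClosed_torus : IsClosed (torus n) := by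
  simp only [torus, ofPred_forall]
  exact isClosed_iInter fun i => isClosed_eq (by fun_prop) continuous_const

theorem torus_subset_closedBall : torus n ⊆ closedBall 0 1 := fun z hz => by
  rw [mem_closedBall_zero_iff, pi_norm_le_iff_of_nonneg zero_le_one]
  exact fun i => (hz i).le

theorem complexExtremePoints_closedBall_subset_torus :
    complexExtremePoints (closedBall (0 : Fin n → ℂ) 1) ⊆ torus n := by
  rintro z ⟨hz, hext⟩ i
  rw [mem_closedBall_zero_iff, pi_norm_le_iff_of_nonneg zero_le_one] at hz
  by_contra hi
  have hlt : ‖z i‖ < 1 := (hz i).lt_of_ne hi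
  refine (sub_pos.2 hlt).ne' (Complex.ofReal_eq_zero.1
    (Pi.single_eq_zero_iff.1 (hext (Pi.single i ((1 - ‖z i‖ : ℝ) : ℂ)) fun ζ hζ => ?_)))
  rw [mem_closedBall_zero_iff, pi_norm_le_iff_of_nonneg zero_le_one]
  intro j
  obtain rfl | hj := eq_or_ne j i
  · rw [Pi.add_apply, Pi.smul_apply, Pi.single_eq_same, smul_eq_mul]
    refine (norm_add_le _ _).trans ?_
    rw [norm_mul, Complex.norm_real, Real.norm_of_nonneg (by linarith)]
    nlinarith
  · simpa [hj] using hz j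

theorem isShilovBoundary_polydisc : IsShilovBoundary (polydisc n) (torus n) := by
  rw [polydisc_eq_ball]
  refine isShilovBoundary_of_peak (isClosedBoundary_ball isClosed_torus torus_subset_closedBall
    complexExtremePoints_closedBall_subset_torus) fun u hu => ?_
  have huu (i) : starRingEnd ℂ (u i) * u i = 1 := by
    rw [← Complex.normSq_eq_conj_mul_self, Complex.normSq_eq_norm_sq, hu i, one_pow,
      Complex.ofReal_one]
  refine ⟨fun z => ∑ i, (1 + starRingEnd ℂ (u i) * z i), Differentiable.diffContOnCl (by fun_prop),
    fun y hy hle => funext fun i => ?_⟩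
  rw [closure_ball 0 one_ne_zero, mem_closedBall_zero_iff,
    pi_norm_le_iff_of_nonneg zero_le_one] at hy
  have huy := eq_one_of_le_norm_sum (a := fun i => starRingEnd ℂ (u i) * y i)
    (fun i => by rw [norm_mul, RCLike.norm_conj, hu i, one_mul]; exact hy i)
    (le_of_eq_of_le (by simp [huu, one_add_one_eq_two, mul_comm]) hle) i
  exact mul_left_cancel₀ (left_ne_zero_of_mul_eq_one (huu i)) (huy.trans (huu i).symm)

end Polydisc

end UnitBalls

section CartanDomain

open Metric Set

section Contraction

variable {H : Type*} [NormedAddCommGroup H] [InnerProductSpace ℂ H] [CompleteSpace H]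
  {T s : H →L[ℂ] H}

theorem norm_one_sub_star_mul_self_apply_sq_le (hT : ‖T‖ ≤ 1) (x : H) :
    ‖(1 - star T * T) x‖ ^ 2 ≤ ‖x‖ ^ 2 - ‖T x‖ ^ 2 := by
  have hinner : RCLike.re (inner ℂ x (star T (T x))) = ‖T x‖ ^ 2 := by
    rw [ContinuousLinearMap.star_eq_adjoint, ContinuousLinearMap.adjoint_inner_right,
      inner_self_eq_norm_sq]
  have hle : ‖star T (T x)‖ ≤ ‖T x‖ := by
    simpa using (star T).le_of_opNorm_le ((norm_star T).trans_le hT) (T x)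
  change ‖x - star T (T x)‖ ^ 2 ≤ _
  rw [@norm_sub_sq ℂ, hinner]
  linarith [pow_le_pow_left₀ (norm_nonneg _) hle 2]

theorem inner_apply_one_sub_mul_star_self (x y : H) :
    inner ℂ (T x) ((1 - T * star T) y) = inner ℂ (T ((1 - star T * T) x)) y := by
  change inner ℂ (T x) (y - T (star T y)) = inner ℂ (T (x - star T (T x))) y
  rw [map_sub, inner_sub_right, inner_sub_left, ContinuousLinearMap.star_eq_adjoint,
    ← ContinuousLinearMap.adjoint_inner_left T, ContinuousLinearMap.adjoint_inner_right T]

theorem norm_add_smul_defect_le_one (hT : ‖T‖ ≤ 1) (hs : ‖s‖ ≤ 1) {ζ : ℂ} (hζ : ‖ζ‖ ≤ 1) :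
    ‖T + ζ • ((1 / 4 : ℂ) • ((1 - T * star T) * s * (1 - star T * T)))‖ ≤ 1 := by
  have hTs : ‖star T‖ ≤ 1 := by rwa [norm_star]
  have happ {A : H →L[ℂ] H} (hA : ‖A‖ ≤ 1) (x : H) : ‖A x‖ ≤ ‖x‖ := by
    simpa using A.le_of_opNorm_le hA x
  refine ContinuousLinearMap.opNorm_le_bound _ zero_le_one fun x => ?_
  set d : H := (1 - star T * T) x with hd
  set w : H := (ζ * (1 / 4)) • (1 - T * star T) (s d) with hw
  have hval : (T + ζ • ((1 / 4 : ℂ) • ((1 - T * star T) * s * (1 - star T * T)))) x = T x + w := by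
    simp only [hw, hd, mul_smul]
    rfl
  have hζ4 : ‖ζ * (1 / 4)‖ ≤ 1 / 4 := by
    rw [norm_mul, show ‖(1 / 4 : ℂ)‖ = 1 / 4 by norm_num]
    linarith
  have hw_norm : ‖w‖ ≤ 1 / 2 * ‖d‖ := by
    have hle : ‖(1 - T * star T) (s d)‖ ≤ 2 * ‖d‖ := by
      refine (norm_sub_le (s d) (T (star T (s d)))).trans ?_
      linarith [happ hT (star T (s d)), happ hTs (s d), happ hs d]
    calc ‖w‖ = ‖ζ * (1 / 4)‖ * ‖(1 - T * star T) (s d)‖ := norm_smul _ _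
      _ ≤ 1 / 4 * (2 * ‖d‖) := by gcongr
      _ = 1 / 2 * ‖d‖ := by ring
  have hw_inner : ‖inner ℂ (T x) w‖ ≤ 1 / 4 * ‖d‖ ^ 2 := by
    rw [hw, inner_smul_right, inner_apply_one_sub_mul_star_self, norm_mul, pow_two]
    gcongr
    exact (norm_inner_le_norm _ _).trans
      (mul_le_mul (happ hT d) (happ hs d) (norm_nonneg _) (norm_nonneg _))
  rw [hval, one_mul]
  refine le_of_sq_le_sq ?_ (norm_nonneg _)
  rw [@norm_add_sq ℂ]
  have hre := (RCLike.re_le_norm (inner ℂ (T x) w)).trans hw_inner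
  have hw_sq := pow_le_pow_left₀ (norm_nonneg _) hw_norm 2
  linarith [norm_one_sub_star_mul_self_apply_sq_le hT x, sq_nonneg ‖d‖]

end Contraction

section Matrices

variable {n : Type*} [Fintype n] [DecidableEq n]

theorem matrix_norm_add_smul_defect_le_one {z s : Matrix n n ℂ} (hz : ‖z‖ ≤ 1) (hs : ‖s‖ ≤ 1)
    {ζ : ℂ} (hζ : ‖ζ‖ ≤ 1) :
    ‖z + ζ • ((1 / 4 : ℂ) • ((1 - z * star z) * s * (1 - star z * z)))‖ ≤ 1 := by
  rw [Matrix.cstar_norm_def] at hz hs ⊢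
  simpa only [map_add, map_smul, map_mul, map_sub, map_one, map_star] using
    norm_add_smul_defect_le_one hz hs hζ

theorem sum_norm_sq_col_le (A : Matrix n n ℂ) (j : n) : ∑ i, ‖A i j‖ ^ 2 ≤ ‖A‖ ^ 2 := by
  have h := Matrix.l2_opNorm_mulVec A (EuclideanSpace.single j (1 : ℂ))
  rw [PiLp.norm_single, norm_one, mul_one] at h
  have hsq := pow_le_pow_left₀ (norm_nonneg _) h 2
  rw [EuclideanSpace.norm_sq_eq] at hsq
  simpa using hsq

theorem norm_entry_le (A : Matrix n n ℂ) (i j : n) : ‖A i j‖ ≤ ‖A‖ :=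
  le_of_sq_le_sq ((Finset.single_le_sum (f := fun i => ‖A i j‖ ^ 2)
    (fun _ _ => sq_nonneg _) (Finset.mem_univ i)).trans (sum_norm_sq_col_le A j)) (norm_nonneg _)

theorem eq_one_of_norm_le_one_of_diag_eq_one {A : Matrix n n ℂ} (hA : ‖A‖ ≤ 1)
    (h : ∀ i, A i i = 1) : A = 1 := by
  ext i j
  obtain rfl | hij := eq_or_ne i j
  · rw [h, Matrix.one_apply_eq]
  rw [Matrix.one_apply_ne hij, ← norm_eq_zero, ← sq_eq_zero_iff]
  have hpair : ∑ k ∈ ({i, j} : Finset n), ‖A k j‖ ^ 2 ≤ ∑ k, ‖A k j‖ ^ 2 :=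
    Finset.sum_le_sum_of_subset_of_nonneg (Finset.subset_univ _) fun _ _ _ => sq_nonneg _
  rw [Finset.sum_pair hij, h j, norm_one] at hpair
  linarith [sum_norm_sq_col_le A j, pow_le_one₀ (norm_nonneg _) hA (n := 2), sq_nonneg ‖A i j‖]

theorem diag_transpose_mul_diagonal_single_mul (D : Matrix n n ℂ) (i j : n) :
    (D.transpose * Matrix.diagonal (Pi.single i 1) * D : Matrix n n ℂ) j j = D i j ^ 2 := by
  rw [Matrix.mul_apply, Finset.sum_eq_single i]
  · rw [Matrix.mul_diagonal, Pi.single_eq_same, Matrix.transpose_apply, mul_one, pow_two]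
  · intro k _ hk
    rw [Matrix.mul_diagonal, Pi.single_eq_of_ne hk, mul_zero, zero_mul]
  · simp

end Matrices

theorem SymMat.apply_comm (z : SymMat) (i j : Fin 2) :
    (z : Matrix (Fin 2) (Fin 2) ℂ) i j = (z : Matrix (Fin 2) (Fin 2) ℂ) j i :=
  congrFun (congrFun z.2 j) i

theorem SymMat.differentiable_apply (i j : Fin 2) :
    Differentiable ℂ fun z : SymMat => (z : Matrix (Fin 2) (Fin 2) ℂ) i j :=
  (((Matrix.entryLinearMap ℂ ℂ i j).comp SymMat.subtype).toContinuousLinearMap).differentiable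

theorem cartanII_eq_ball : cartanII = ball 0 1 := by
  ext z
  rw [mem_ball_zero_iff]
  rfl

theorem isClosed_symUnitary : IsClosed symUnitary :=
  isClosed_unitary.preimage continuous_subtype_val

theorem norm_le_one_of_mem_symUnitary {u : SymMat} (hu : u ∈ symUnitary) : ‖u‖ ≤ 1 :=
  (CStarRing.norm_of_mem_unitary (U := (u : Matrix (Fin 2) (Fin 2) ℂ)) hu).le

/- If the defect `D = 1 - z* z` has a nonzero entry in row `i`, the disc in the direction of the
symmetric matrix `Dᵗ Eᵢᵢ D` stays in the closed ball. -/
theorem complexExtremePoints_closedBall_subset_symUnitary :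
    complexExtremePoints (closedBall (0 : SymMat) 1) ⊆ symUnitary := by
  rintro ⟨z, hzs⟩ ⟨hz, hext⟩
  rw [mem_closedBall_zero_iff] at hz
  have hzt : z.transpose = z := hzs
  have hst : (star z).transpose = star z := congrArg star hzt
  set D : Matrix (Fin 2) (Fin 2) ℂ := 1 - star z * z with hD
  have hDt : D.transpose = 1 - z * star z := by
    rw [hD, Matrix.transpose_sub, Matrix.transpose_one, Matrix.transpose_mul, hzt, hst]
  suffices hD0 : D = 0 from Matrix.mem_unitaryGroup_iff'.2 (sub_eq_zero.1 hD0).symm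
  ext i j
  set v : Matrix (Fin 2) (Fin 2) ℂ :=
    (1 / 4 : ℂ) • (D.transpose * Matrix.diagonal (Pi.single i 1) * D) with hv
  have hvs : v.transpose = v := by
    rw [hv, Matrix.transpose_smul, Matrix.transpose_mul, Matrix.transpose_mul,
      Matrix.transpose_transpose, Matrix.diagonal_transpose, Matrix.mul_assoc]
  have hv0 : v = 0 := congrArg Subtype.val <| hext ⟨v, hvs⟩ fun ζ hζ => by
    rw [mem_closedBall_zero_iff]
    change ‖z + ζ • v‖ ≤ 1
    rw [hv, hDt]
    refine matrix_norm_add_smul_defect_le_one hz ?_ hζ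
    rw [Matrix.l2_opNorm_diagonal, Pi.norm_single, norm_one]
  have hvj : v j j = 1 / 4 * D i j ^ 2 := by
    rw [hv, Matrix.smul_apply, diag_transpose_mul_diagonal_single_mul, smul_eq_mul]
  rw [hv0] at hvj
  simpa using hvj.symm

theorem eq_of_two_mul_le_norm_sum_star_mul {u y : SymMat} (hu : u ∈ symUnitary) (hy : ‖y‖ ≤ 1)
    (h : 2 * (Fintype.card (Fin 2) : ℝ) ≤ ‖∑ i, (1 + (star (u : Matrix (Fin 2) (Fin 2) ℂ) *
      (y : Matrix (Fin 2) (Fin 2) ℂ)) i i)‖) : y = u := by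
  have hyu : ‖star (u : Matrix (Fin 2) (Fin 2) ℂ) * (y : Matrix (Fin 2) (Fin 2) ℂ)‖ ≤ 1 := by
    refine (norm_mul_le _ _).trans (mul_le_one₀ ?_ (norm_nonneg _) hy)
    rw [norm_star]
    exact norm_le_one_of_mem_symUnitary hu
  have hone := eq_one_of_norm_le_one_of_diag_eq_one hyu
    (eq_one_of_le_norm_sum (fun i => (norm_entry_le _ i i).trans hyu) h)
  refine Subtype.ext ?_
  calc (y : Matrix (Fin 2) (Fin 2) ℂ) = u * star (u : Matrix (Fin 2) (Fin 2) ℂ) * y := by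
        rw [Matrix.mem_unitaryGroup_iff.1 hu, Matrix.one_mul]
    _ = u := by rw [Matrix.mul_assoc, hone, Matrix.mul_one]

theorem isShilovBoundary_cartanII : IsShilovBoundary cartanII symUnitary := by
  rw [cartanII_eq_ball]
  refine isShilovBoundary_of_peak (isClosedBoundary_ball isClosed_symUnitary
    (fun z hz => mem_closedBall_zero_iff.2 (norm_le_one_of_mem_symUnitary hz))
    complexExtremePoints_closedBall_subset_symUnitary) fun u hu => ?_
  refine ⟨fun z => ∑ i, (1 + (star (u : Matrix (Fin 2) (Fin 2) ℂ) *
    (z : Matrix (Fin 2) (Fin 2) ℂ)) i i), Differentiable.diffContOnCl ?_, fun y hy hle => ?_⟩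
  · simp only [Matrix.mul_apply]
    exact Differentiable.fun_sum fun i _ => (differentiable_const _).add
      (Differentiable.fun_sum fun j _ => (SymMat.differentiable_apply j i).const_mul _)
  · rw [closure_ball 0 one_ne_zero, mem_closedBall_zero_iff] at hy
    refine eq_of_two_mul_le_norm_sum_star_mul hu hy (le_of_eq_of_le ?_ hle)
    simp only [Matrix.mem_unitaryGroup_iff'.1 hu, Matrix.one_apply_eq]
    norm_num

end CartanDomain

section ProperMapsOfTheWholeSpace

open Metric Set Topology

theorem isDomainSet_univ {V : Type*} [TopologicalSpace V] [ConnectedSpace V] :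
    IsDomainSet (univ : Set V) :=
  ⟨isOpen_univ, isConnected_univ⟩

theorem isProperHolomorphic_univ {V W : Type*} [NormedAddCommGroup V] [NormedSpace ℂ V]
    [ProperSpace V] [NormedAddCommGroup W] [NormedSpace ℂ W] {f : V → W} (hf : Differentiable ℂ f)
    (hb : ∀ R : ℝ, ∃ R' : ℝ, ∀ z, ‖f z‖ ≤ R → ‖z‖ ≤ R') :
    IsProperHolomorphic f univ univ := by
  refine ⟨hf.differentiableOn, mapsTo_univ _ _, fun C _ hC => ?_⟩
  obtain ⟨R, hR⟩ := hC.isBounded.exists_norm_le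
  obtain ⟨R', hR'⟩ := hb R
  rw [univ_inter]
  exact (isCompact_closedBall (0 : V) R').of_isClosed_subset (hC.isClosed.preimage hf.continuous)
    fun z hz => mem_closedBall_zero_iff.2 (hR' z (hR _ hz))

theorem IsProperHolomorphic.isQuotientMap {n : ℕ} {f : (Fin n → ℂ) → (Fin n → ℂ)}
    (hf : IsProperHolomorphic f univ univ) : IsQuotientMap f := by
  have hprop : IsProperMap f := isProperMap_iff_isCompact_preimage.2
    ⟨continuousOn_univ.1 hf.1.continuousOn, fun K hK => by
      simpa using hf.2.2 K (subset_univ K) hK⟩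
  refine hprop.isClosedMap.isQuotientMap hprop.continuous fun z => ?_
  obtain ⟨w, -, hw⟩ := hf.subset_image isOpen_univ isOpen_univ isPreconnected_univ univ_nonempty
    (mem_univ z)
  exact ⟨w, hw⟩

theorem relCompactIn_univ_of_subset {V : Type*} [TopologicalSpace V] [T2Space V] {L K : Set V}
    (hK : IsCompact K) (h : L ⊆ K) : RelCompactIn L univ :=
  ⟨hK.closure_of_subset h, subset_univ _⟩

end ProperMapsOfTheWholeSpace

section ElementarySymmetric

open Metric Set

theorem eq_of_forall_esymm_eq {R : Type*} [CommRing R] [IsDomain R] {s t : Multiset R}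
    (hcard : s.card = t.card) (h : ∀ k < s.card, s.esymm (k + 1) = t.esymm (k + 1)) : s = t := by
  have hprod : (s.map fun a => Polynomial.X - Polynomial.C a).prod =
      (t.map fun a => Polynomial.X - Polynomial.C a).prod := by
    rw [Multiset.prod_X_sub_X_eq_sum_esymm, Multiset.prod_X_sub_X_eq_sum_esymm, ← hcard]
    refine Finset.sum_congr rfl fun j hj => ?_
    obtain _ | k := j
    · simp [Multiset.esymm]
    · rw [h k (by simpa using hj)]
  simpa only [Polynomial.roots_multiset_prod_X_sub_C] using congrArg Polynomial.roots hprod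

theorem norm_le_add_one_of_forall_norm_esymm_le {K : Type*} [NormedField K] {s : Multiset K}
    {R : NNReal} (h : ∀ k < s.card, ‖s.esymm (k + 1)‖₊ ≤ R) {a : K} (ha : a ∈ s) :
    ‖a‖ ≤ R + 1 := by
  set p : Polynomial K := (s.map fun t => Polynomial.X - Polynomial.C t).prod with hp
  have hdeg : p.natDegree = s.card := Polynomial.natDegree_multiset_prod_X_sub_C_eq_card s
  have hmon : p.Monic := Polynomial.monic_multisetProd_X_sub_C s
  have hroot : p.IsRoot a := by
    rwa [← Polynomial.mem_roots hmon.ne_zero, hp, Polynomial.roots_multiset_prod_X_sub_C]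
  have hbound : p.cauchyBound ≤ R + 1 := by
    rw [Polynomial.cauchyBound, hmon.leadingCoeff, nnnorm_one, div_one]
    refine add_le_add_left (Finset.sup_le fun k hk => ?_) 1
    rw [hdeg, Finset.mem_range] at hk
    rw [hp, Multiset.prod_X_sub_C_coeff s hk.le, nnnorm_mul, nnnorm_pow, nnnorm_neg,
      nnnorm_one, one_pow, one_mul, show s.card - k = s.card - k - 1 + 1 by lia]
    exact h _ (by lia)
  exact_mod_cast ((hroot.norm_lt_cauchyBound hmon.ne_zero).trans_le hbound).le

variable {n : ℕ}

theorem symMap_apply (z : Fin n → ℂ) (k : Fin n) :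
    symMap n z k = ((Finset.univ : Finset (Fin n)).val.map z).esymm (k + 1) :=
  (Finset.esymm_map_val z _ _).symm

theorem map_univ_eq_of_symMap_eq {z w : Fin n → ℂ} (h : symMap n z = symMap n w) :
    (Finset.univ : Finset (Fin n)).val.map z = (Finset.univ : Finset (Fin n)).val.map w := by
  refine eq_of_forall_esymm_eq (by simp) fun k hk => ?_
  simpa only [symMap_apply] using congrFun h ⟨k, by simpa using hk⟩

theorem norm_le_of_norm_symMap_le {R : ℝ} {z : Fin n → ℂ} (hz : ‖symMap n z‖ ≤ R) :
    ‖z‖ ≤ R + 1 := by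
  have hR : 0 ≤ R := (norm_nonneg _).trans hz
  lift R to NNReal using hR
  refine (pi_norm_le_iff_of_nonneg (by positivity)).2 fun i =>
    norm_le_add_one_of_forall_norm_esymm_le (s := (Finset.univ : Finset (Fin n)).val.map z)
      (fun k hk => ?_) (Multiset.mem_map_of_mem z (Finset.mem_univ i))
  simpa only [symMap_apply, ← NNReal.coe_le_coe, coe_nnnorm] using
    (norm_le_pi_norm (symMap n z) ⟨k, by simpa using hk⟩).trans hz

theorem differentiable_symMap : Differentiable ℂ (symMap n) := by
  refine differentiable_pi.2 fun k => ?_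
  unfold symMap
  fun_prop

theorem isProperHolomorphic_symMap (n : ℕ) :
    IsProperHolomorphic (symMap n) Set.univ Set.univ :=
  isProperHolomorphic_univ differentiable_symMap fun R =>
    ⟨R + 1, fun _ hz => norm_le_of_norm_symMap_le hz⟩

theorem symMap_preimage_symPolydisc (n : ℕ) : symMap n ⁻¹' symPolydisc n = polydisc n := by
  refine Subset.antisymm (fun z hz i => ?_) (subset_preimage_image _ _)
  obtain ⟨w, hw, hwz⟩ := hz
  have hmem : z i ∈ (Finset.univ : Finset (Fin n)).val.map w := by
    rw [map_univ_eq_of_symMap_eq hwz]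
    exact Multiset.mem_map_of_mem z (Finset.mem_univ i)
  obtain ⟨j, -, hj⟩ := Multiset.mem_map.1 hmem
  exact hj ▸ hw j

theorem isDomainSet_symPolydisc (n : ℕ) : IsDomainSet (symPolydisc n) := by
  constructor
  · rw [← (isProperHolomorphic_symMap n).isQuotientMap.isOpen_preimage,
      symMap_preimage_symPolydisc, polydisc_eq_ball]
    exact isOpen_ball
  · refine IsConnected.image ?_ _ differentiable_symMap.continuous.continuousOn
    rw [polydisc_eq_ball]
    exact (convex_ball _ _).isConnected ⟨0, mem_ball_self one_pos⟩

theorem relCompactIn_symPolydisc (n : ℕ) : RelCompactIn (symPolydisc n) Set.univ := by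
  refine relCompactIn_univ_of_subset
    ((isCompact_closedBall (0 : Fin n → ℂ) 1).image differentiable_symMap.continuous)
    (image_mono ?_)
  rw [polydisc_eq_ball]
  exact ball_subset_closedBall

theorem shilovBoundary_symPolydisc (n : ℕ) :
    shilovBoundary (symPolydisc n) = symMap n '' torus n := by
  rw [shilovBoundary_eq_image isOpen_univ univ_nonempty isDomainSet_univ
    (isProperHolomorphic_symMap n) (isDomainSet_symPolydisc n).1 (relCompactIn_symPolydisc n),
    univ_inter, symMap_preimage_symPolydisc, isShilovBoundary_polydisc.eq]

end ElementarySymmetric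

section Tetrablock

open Metric Set

variable {V W : Type*} [NormedAddCommGroup V] [NormedSpace ℂ V] [NormedAddCommGroup W]
  [NormedSpace ℂ W]

theorem IsClosedBoundary.preimage_equiv (e : V ≃L[ℂ] W) {D S : Set W} (h : IsClosedBoundary D S) :
    IsClosedBoundary (e ⁻¹' D) (e ⁻¹' S) := by
  have hcl : closure (e ⁻¹' D) = e ⁻¹' closure D := (e.toHomeomorph.preimage_closure D).symm
  refine ⟨h.1.preimage e.continuous, hcl ▸ preimage_mono h.2.1, fun g hg x hx => ?_⟩
  rw [hcl] at hx
  have hge : DiffContOnCl ℂ (g ∘ e.symm) D :=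
    hg.comp e.symm.differentiable.diffContOnCl fun y hy => by
      rwa [mem_preimage, e.apply_symm_apply]
  obtain ⟨y, hy, hxy⟩ := h.2.2 _ hge (e x) hx
  exact ⟨e.symm y, by rwa [mem_preimage, e.apply_symm_apply], by simpa using hxy⟩

theorem IsShilovBoundary.preimage_equiv (e : V ≃L[ℂ] W) {D S : Set W} (h : IsShilovBoundary D S) :
    IsShilovBoundary (e ⁻¹' D) (e ⁻¹' S) := by
  refine ⟨h.1.preimage_equiv e, fun T hT x hx => ?_⟩
  have hT' : IsClosedBoundary (e.symm ⁻¹' (e ⁻¹' D)) (e.symm ⁻¹' T) :=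
    IsClosedBoundary.preimage_equiv e.symm hT
  rw [e.symm_preimage_preimage] at hT'
  simpa using h.2 hT' hx

/-- The coordinates `(z₁₁, z₂₂, z₁₂)` on the space of symmetric matrices, in which `tetraMap`
becomes a map between spaces `Fin 3 → ℂ`. -/
noncomputable def symMatEquiv : (Fin 3 → ℂ) ≃L[ℂ] SymMat :=
  LinearEquiv.toContinuousLinearEquiv
    { toFun := fun z => ⟨!![z 0, z 2; z 2, z 1], by
        ext i j
        fin_cases i <;> fin_cases j <;> rfl⟩
      map_add' := fun z w => by
        ext i j
        fin_cases i <;> fin_cases j <;> rfl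
      map_smul' := fun c z => by
        ext i j
        fin_cases i <;> fin_cases j <;> rfl
      invFun := fun A => ![(A : Matrix (Fin 2) (Fin 2) ℂ) 0 0, (A : Matrix (Fin 2) (Fin 2) ℂ) 1 1,
        (A : Matrix (Fin 2) (Fin 2) ℂ) 0 1]
      left_inv := fun z => by
        ext i
        fin_cases i <;> rfl
      right_inv := fun A => by
        ext i j
        have := SymMat.apply_comm A 0 1
        fin_cases i <;> fin_cases j
        exacts [rfl, rfl, this, rfl] }

/-- The map `tetraMap` in the coordinates `symMatEquiv`. -/
noncomputable def tetraCoord (z : Fin 3 → ℂ) : Fin 3 → ℂ := tetraMap !![z 0, z 2; z 2, z 1]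

theorem tetraCoord_eq (z : Fin 3 → ℂ) : tetraCoord z = ![z 0, z 1, z 0 * z 1 - z 2 * z 2] := by
  rw [tetraCoord, tetraMap, Matrix.det_fin_two_of]
  rfl

theorem differentiable_tetraCoord : Differentiable ℂ tetraCoord := by
  refine differentiable_pi.2 fun k => ?_
  simp only [tetraCoord_eq]
  fin_cases k
  · exact differentiable_apply 0
  · exact differentiable_apply 1
  · change Differentiable ℂ fun z : Fin 3 → ℂ => z 0 * z 1 - z 2 * z 2
    fun_prop

theorem tetraMap_eq_tetraCoord (A : SymMat) : tetraMap A = tetraCoord (symMatEquiv.symm A) := by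
  rw [tetraCoord, show !![_, _; _, _] = (symMatEquiv (symMatEquiv.symm A) : Matrix _ _ ℂ) from rfl,
    ContinuousLinearEquiv.apply_symm_apply]

theorem image_tetraMap (S : Set SymMat) :
    (fun A : SymMat => tetraMap A) '' S = tetraCoord '' (symMatEquiv ⁻¹' S) := by
  rw [← ContinuousLinearEquiv.image_symm_eq_preimage, image_image]
  exact image_congr fun A _ => tetraMap_eq_tetraCoord A

theorem continuous_tetraMap : Continuous fun A : SymMat => tetraMap A := by
  simp only [tetraMap_eq_tetraCoord]
  exact differentiable_tetraCoord.continuous.comp symMatEquiv.symm.continuous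

theorem norm_le_of_norm_tetraCoord_le {R : ℝ} {z : Fin 3 → ℂ} (hz : ‖tetraCoord z‖ ≤ R) :
    ‖z‖ ≤ 1 + R + R ^ 2 := by
  have hR : 0 ≤ R := (norm_nonneg _).trans hz
  rw [pi_norm_le_iff_of_nonneg hR, tetraCoord_eq] at hz
  have h0 : ‖z 0‖ ≤ R := hz 0
  have h1 : ‖z 1‖ ≤ R := hz 1
  have hdet : ‖z 0 * z 1 - z 2 * z 2‖ ≤ R := hz 2
  have h2 : ‖z 2‖ * ‖z 2‖ ≤ R * R + R := calc
    ‖z 2‖ * ‖z 2‖ = ‖z 0 * z 1 - (z 0 * z 1 - z 2 * z 2)‖ := by rw [sub_sub_cancel, norm_mul]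
    _ ≤ ‖z 0‖ * ‖z 1‖ + ‖z 0 * z 1 - z 2 * z 2‖ := by
        rw [← norm_mul]
        exact norm_sub_le _ _
    _ ≤ R * R + R := by gcongr
  refine (pi_norm_le_iff_of_nonneg (by positivity)).2 fun i => ?_
  fin_cases i
  · exact h0.trans (by nlinarith)
  · exact h1.trans (by nlinarith)
  · change ‖z 2‖ ≤ _
    nlinarith [norm_nonneg (z 2)]

theorem isProperHolomorphic_tetraCoord : IsProperHolomorphic tetraCoord univ univ :=
  isProperHolomorphic_univ differentiable_tetraCoord fun R =>
    ⟨1 + R + R ^ 2, fun _ hz => norm_le_of_norm_tetraCoord_le hz⟩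

theorem norm_neg_offDiag (a b c d : ℂ) : ‖!![a, -b; -c, d]‖ = ‖!![a, b; c, d]‖ := by
  have hmul : !![a, -b; -c, d] = Matrix.diagonal ![1, -1] * !![a, b; c, d] *
      Matrix.diagonal ![1, -1] := by
    ext i j
    fin_cases i <;> fin_cases j <;> simp [Matrix.diagonal_mul, Matrix.mul_diagonal]
  have hunitary : Matrix.diagonal ![1, -1] ∈ unitary (Matrix (Fin 2) (Fin 2) ℂ) := by
    refine Matrix.mem_unitaryGroup_iff.2 ?_
    rw [Matrix.star_eq_conjTranspose, Matrix.diagonal_conjTranspose, Matrix.diagonal_mul_diagonal,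
      ← Matrix.diagonal_one]
    congr 1
    ext i
    fin_cases i <;> simp
  rw [hmul, CStarRing.norm_mul_mem_unitary _ hunitary, CStarRing.norm_mem_unitary_mul _ hunitary]

theorem tetraCoord_preimage_tetrablock :
    tetraCoord ⁻¹' tetrablock = symMatEquiv ⁻¹' cartanII := by
  rw [tetrablock, image_tetraMap]
  refine Subset.antisymm (fun z hz => ?_) (subset_preimage_image _ _)
  obtain ⟨w, hw, hwz⟩ := hz
  rw [tetraCoord_eq, tetraCoord_eq] at hwz
  have h0 : w 0 = z 0 := congrFun hwz 0
  have h1 : w 1 = z 1 := congrFun hwz 1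
  have hdet : w 0 * w 1 - w 2 * w 2 = z 0 * z 1 - z 2 * z 2 := congrFun hwz 2
  have h2 : z 2 * z 2 = w 2 * w 2 := by
    rw [h0, h1] at hdet
    linear_combination hdet
  change ‖!![w 0, w 2; w 2, w 1]‖ < 1 at hw
  change ‖!![z 0, z 2; z 2, z 1]‖ < 1
  rw [h0, h1] at hw
  obtain h | h := mul_self_eq_mul_self_iff.1 h2
  · rwa [h]
  · rwa [h, norm_neg_offDiag]

theorem isDomainSet_tetrablock : IsDomainSet tetrablock := by
  constructor
  · rw [← isProperHolomorphic_tetraCoord.isQuotientMap.isOpen_preimage,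
      tetraCoord_preimage_tetrablock, cartanII_eq_ball]
    exact isOpen_ball.preimage symMatEquiv.continuous
  · refine IsConnected.image ?_ _ continuous_tetraMap.continuousOn
    rw [cartanII_eq_ball]
    exact (convex_ball _ _).isConnected ⟨0, mem_ball_self one_pos⟩

theorem relCompactIn_tetrablock : RelCompactIn tetrablock univ := by
  have : ProperSpace SymMat := FiniteDimensional.proper ℂ SymMat
  refine relCompactIn_univ_of_subset
    ((isCompact_closedBall (0 : SymMat) 1).image continuous_tetraMap) (image_mono ?_)
  rw [cartanII_eq_ball]
  exact ball_subset_closedBall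

theorem shilovBoundary_tetrablock :
    shilovBoundary tetrablock = (fun z : SymMat => tetraMap z) '' symUnitary := by
  rw [shilovBoundary_eq_image isOpen_univ univ_nonempty isDomainSet_univ
    isProperHolomorphic_tetraCoord isDomainSet_tetrablock.1 relCompactIn_tetrablock, univ_inter,
    tetraCoord_preimage_tetrablock, (isShilovBoundary_cartanII.preimage_equiv symMatEquiv).eq,
    ← image_tetraMap]

end Tetrablock

theorem mainTheorem9_general :
    (IsShilovBoundary tetrablock (shilovBoundary tetrablock) ∧
      IsShilovBoundary cartanII (shilovBoundary cartanII) ∧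
      shilovBoundary tetrablock = (fun z : SymMat => tetraMap z) '' shilovBoundary cartanII ∧
      shilovBoundary cartanII = symUnitary ∧
      shilovBoundary tetrablock = (fun z : SymMat => tetraMap z) '' symUnitary) ∧
    (∀ n : ℕ,
      IsShilovBoundary (symPolydisc n) (shilovBoundary (symPolydisc n)) ∧
      IsShilovBoundary (polydisc n) (shilovBoundary (polydisc n)) ∧
      shilovBoundary (symPolydisc n) = symMap n '' shilovBoundary (polydisc n) ∧
      shilovBoundary (polydisc n) = torus n ∧
      shilovBoundary (symPolydisc n) = symMap n '' torus n) ∧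
    (∀ (n : ℕ) (D G L : Set (Fin n → ℂ)) (f : (Fin n → ℂ) → (Fin n → ℂ)),
      IsOpen D → D.Nonempty → IsDomainSet G → IsProperHolomorphic f D G →
      IsOpen L → RelCompactIn L G →
      IsShilovBoundary L (shilovBoundary L) ∧
      IsShilovBoundary (D ∩ f ⁻¹' L) (shilovBoundary (D ∩ f ⁻¹' L)) ∧
      shilovBoundary L = f '' shilovBoundary (D ∩ f ⁻¹' L)) ∧
    (IsProperHolomorphic (fun z : Fin 3 → ℂ => tetraMap !![z 0, z 2; z 2, z 1])
        Set.univ Set.univ ∧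
      IsDomainSet tetrablock ∧ RelCompactIn tetrablock Set.univ ∧
      (fun z : Fin 3 → ℂ => tetraMap !![z 0, z 2; z 2, z 1]) ⁻¹' tetrablock =
        {z | ‖!![z 0, z 2; z 2, z 1]‖ < 1}) ∧
    (∀ n : ℕ,
      IsProperHolomorphic (symMap n) Set.univ Set.univ ∧
      IsDomainSet (symPolydisc n) ∧ RelCompactIn (symPolydisc n) Set.univ ∧
      symMap n ⁻¹' symPolydisc n = polydisc n) := by
  have hE := isShilovBoundary_shilovBoundary relCompactIn_tetrablock.1
  have hG (n : ℕ) := isShilovBoundary_shilovBoundary (relCompactIn_symPolydisc n).1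
  simp only [isShilovBoundary_cartanII.eq, isShilovBoundary_polydisc.eq]
  refine ⟨⟨hE, isShilovBoundary_cartanII, shilovBoundary_tetrablock, trivial,
    shilovBoundary_tetrablock⟩,
    fun n => ⟨hG n, isShilovBoundary_polydisc, shilovBoundary_symPolydisc n, trivial,
      shilovBoundary_symPolydisc n⟩,
    fun n D G L f hD hDne hG hf hLo hL => ⟨isShilovBoundary_shilovBoundary hL.1,
      isShilovBoundary_shilovBoundary (isCompact_closure_inter_preimage hf hL),
      shilovBoundary_eq_image hD hDne hG hf hLo hL⟩,
    ⟨isProperHolomorphic_tetraCoord, isDomainSet_tetrablock, relCompactIn_tetrablock,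
      tetraCoord_preimage_tetrablock⟩,
    fun n => ⟨isProperHolomorphic_symMap n, isDomainSet_symPolydisc n,
      relCompactIn_symPolydisc n, symMap_preimage_symPolydisc n⟩⟩

theorem mainTheorem9 :
    -- the tetrablock
    (IsShilovBoundary tetrablock (shilovBoundary tetrablock) ∧
      IsShilovBoundary cartanII (shilovBoundary cartanII) ∧
      shilovBoundary tetrablock = (fun z : SymMat => tetraMap z) '' shilovBoundary cartanII ∧
      shilovBoundary cartanII = symUnitary ∧
      shilovBoundary tetrablock = (fun z : SymMat => tetraMap z) '' symUnitary) ∧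
    -- the symmetrized polydisc
    (∀ n : ℕ,
      IsShilovBoundary (symPolydisc n) (shilovBoundary (symPolydisc n)) ∧
      IsShilovBoundary (polydisc n) (shilovBoundary (polydisc n)) ∧
      shilovBoundary (symPolydisc n) = symMap n '' shilovBoundary (polydisc n) ∧
      shilovBoundary (polydisc n) = torus n ∧
      shilovBoundary (symPolydisc n) = symMap n '' torus n) ∧
    -- the class: relatively compact subdomains of targets of proper holomorphic maps
    (∀ (n : ℕ) (D G L : Set (Fin n → ℂ)) (f : (Fin n → ℂ) → (Fin n → ℂ)),
      IsDomainSet D → IsDomainSet G → IsProperHolomorphic f D G →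
      IsDomainSet L → RelCompactIn L G →
      IsShilovBoundary L (shilovBoundary L) ∧
      IsShilovBoundary (D ∩ f ⁻¹' L) (shilovBoundary (D ∩ f ⁻¹' L)) ∧
      shilovBoundary L = f '' shilovBoundary (D ∩ f ⁻¹' L)) ∧
    -- the class applies to the tetrablock, in the coordinates `(z₁₁, z₂₂, z₁₂)`
    (IsProperHolomorphic (fun z : Fin 3 → ℂ => tetraMap !![z 0, z 2; z 2, z 1])
        Set.univ Set.univ ∧
      IsDomainSet tetrablock ∧ RelCompactIn tetrablock Set.univ ∧
      (fun z : Fin 3 → ℂ => tetraMap !![z 0, z 2; z 2, z 1]) ⁻¹' tetrablock =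
        {z | ‖!![z 0, z 2; z 2, z 1]‖ < 1}) ∧
    -- the class applies to the symmetrized polydisc
    (∀ n : ℕ,
      IsProperHolomorphic (symMap n) Set.univ Set.univ ∧
      IsDomainSet (symPolydisc n) ∧ RelCompactIn (symPolydisc n) Set.univ ∧
      symMap n ⁻¹' symPolydisc n = polydisc n) :=
  ⟨mainTheorem9_general.1, mainTheorem9_general.2.1, fun n D G L f hD hG hf hLd =>
    mainTheorem9_general.2.2.1 n D G L f hD.1 hD.2.nonempty hG hf hLd.1,
    mainTheorem9_general.2.2.2⟩
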